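/- Let $k$ be a commutative ring with unit, $A$ and $B$ unital associative $k$-algebras, $M$ an $(A,B)$-bimodule (on which $k$ acts centrally, i.e. an $A\otimes_k B^{\mathrm{op}}$-module), $E=\begin{pmatrix}A&M\\0&B\end{pmatrix}$ the triangular matrix algebra and $X$ an $E$-bimodule (again $k$-central). Write $1_A,1_B\in E$ for the idempotents given by the units of $A$ and $B$; put $X_{AA}=1_AX1_A$, an $A$-bimodule, and regard $1_BX$, a $(B,E)$-bimodule, as a right $E\otimes_k B^{\mathrm{op}}$-module by $x\cdot(e\otimes b)=bxe$. Let $\pi\colon E\to B$ be the projection $\begin{pmatrix}a&m\\0&b\end{pmatrix}\mapsto b$, and let $B_E$ be $B$ viewed as an $E$-bimodule via $\pi$; as a left $E\otimes_k B^{\mathrm{op}}$-module it has the action $(e\otimes b)\cdot y=\pi(e)\,y\,b$. For a $k$-algebra $C$ and a $C$-bimodule $Y$ let $H_n(C,Y)$ be Hochschild homology, the homology of the complex $(Y\otimes_k C^{\otimes_k *},b)$. For a $k$-algebra $R$, a left $R$-module $Z$ and a right $R$-module $N$ let $\operatorname{Tor}^{R,k}_n(Z,N)$ be $\operatorname{Tor}$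 relative to the $R$-linear epimorphisms which split $k$-linearly: $\operatorname{Tor}^{R,k}_n(Z,N)=H_n(N\otimes_R P_*)$, where $P_*\to Z$ is any resolution of $Z$ by $R$-modules that are projective relative to these epimorphisms, such that the augmented complex $\cdots\to P_1\to P_0\to Z\to 0$ is contractible as a complex of $k$-modules. Then there exists a long exact sequence of $k$-modules $$ \begin{aligned} \cdots&\to H_1(A,X_{AA})\to H_1(E,X)\to \operatorname{Tor}_1^{E\otimes B^{\mathrm{op}},k}(B_E,1_BX)\to\\ &\to H_0(A,X_{AA})\to H_0(E,X)\to \operatorname{Tor}_0^{E\otimes B^{\mathrm{op}},k}(B_E,1_BX)\to 0. \end{aligned} $$ -/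

import Mathlib

open scoped TensorProduct
open MulOpposite

universe u

noncomputable section

set_option linter.unusedSectionVars false
set_option linter.unusedVariables false

/-! ## The triangular algebra -/

/-- The triangular matrices with entries `a : A` (upper left), `m : M` (upper right) and
`b : B` (lower right). -/
@[ext]
structure TriAlg (A B M : Type u) : Type u where
  a : A
  m : M
  b : B

namespace TriAlg

/-- The underlying set is `A × M × B`. -/
def equivProd (A B M : Type u) : TriAlg A B M ≃ A × M × B where
  toFun x := (x.a, x.m, x.b)
  invFun x := ⟨x.1, x.2.1, x.2.2⟩
  left_inv _ := rfl
  right_inv _ := rfl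

instance {A B M : Type u} [AddCommGroup A] [AddCommGroup B] [AddCommGroup M] :
    AddCommGroup (TriAlg A B M) := (equivProd A B M).addCommGroup

instance {k A B M : Type u} [Semiring k] [AddCommGroup A] [AddCommGroup B] [AddCommGroup M]
    [Module k A] [Module k B] [Module k M] : Module k (TriAlg A B M) :=
  (equivProd A B M).module k

section

variable {A B M : Type u}

section

variable [AddCommGroup A] [AddCommGroup B] [AddCommGroup M]

@[simp] theorem zero_a : (0 : TriAlg A B M).a = 0 := rfl
@[simp] theorem zero_m : (0 : TriAlg A B M).m = 0 := rfl
@[simp] theorem zero_b : (0 : TriAlg A B M).b = 0 := rfl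
@[simp] theorem add_a (x y : TriAlg A B M) : (x + y).a = x.a + y.a := rfl
@[simp] theorem add_m (x y : TriAlg A B M) : (x + y).m = x.m + y.m := rfl
@[simp] theorem add_b (x y : TriAlg A B M) : (x + y).b = x.b + y.b := rfl

variable {k : Type u} [Semiring k] [Module k A] [Module k B] [Module k M]

@[simp] theorem smul_a (c : k) (x : TriAlg A B M) : (c • x).a = c • x.a := rfl
@[simp] theorem smul_m (c : k) (x : TriAlg A B M) : (c • x).m = c • x.m := rfl
@[simp] theorem smul_b (c : k) (x : TriAlg A B M) : (c • x).b = c • x.b := rfl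

end

variable [Ring A] [Ring B] [AddCommGroup M] [Module A M] [Module Bᵐᵒᵖ M]

instance : One (TriAlg A B M) := ⟨⟨1, 0, 1⟩⟩

/-- Multiplication of triangular matrices; `op b • m` is the right action `m b`. -/
instance : Mul (TriAlg A B M) :=
  ⟨fun x y => ⟨x.a * y.a, x.a • y.m + op y.b • x.m, x.b * y.b⟩⟩

@[simp] theorem one_a : (1 : TriAlg A B M).a = 1 := rfl
@[simp] theorem one_m : (1 : TriAlg A B M).m = 0 := rfl
@[simp] theorem one_b : (1 : TriAlg A B M).b = 1 := rfl
@[simp] theorem mul_a (x y : TriAlg A B M) : (x * y).a = x.a * y.a := rfl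
@[simp] theorem mul_m (x y : TriAlg A B M) : (x * y).m = x.a • y.m + op y.b • x.m := rfl
@[simp] theorem mul_b (x y : TriAlg A B M) : (x * y).b = x.b * y.b := rfl

variable [SMulCommClass A Bᵐᵒᵖ M]

instance : Ring (TriAlg A B M) where
  __ := (inferInstance : AddCommGroup (TriAlg A B M))
  mul_assoc x y z := by
    ext <;> simp [mul_assoc, mul_smul, smul_add, smul_comm x.a (op z.b), add_assoc]
  one_mul x := by ext <;> simp
  mul_one x := by ext <;> simp
  zero_mul x := by ext <;> simp
  mul_zero x := by ext <;> simp
  left_distrib x y z := by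
    ext <;> simp [mul_add, add_smul]
    abel
  right_distrib x y z := by
    ext <;> simp [add_mul, add_smul]
    abel

instance {k : Type u} [CommRing k] [Algebra k A] [Algebra k B] [Module k M]
    [IsScalarTower k A M] [IsScalarTower k Bᵐᵒᵖ M] : Algebra k (TriAlg A B M) :=
  Algebra.ofModule
    (fun c x y => by
      ext
      · simp
      · have h' : op y.b • c • x.m = c • op y.b • x.m := by
          rw [← algebraMap_smul Bᵐᵒᵖ c x.m, ← algebraMap_smul Bᵐᵒᵖ c (op y.b • x.m),
            ← mul_smul, ← mul_smul, Algebra.commutes]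
        simp [smul_add, h']
      · simp)
    (fun c x y => by
      ext
      · simp
      · have h : x.a • c • y.m = c • x.a • y.m := by
          rw [← algebraMap_smul A c y.m, ← algebraMap_smul A c (x.a • y.m), ← mul_smul,
            ← mul_smul, Algebra.commutes]
        simp [smul_add, h]
      · simp)

/-- The matrix whose only non-zero entry is `a : A`. -/
def inA (a : A) : TriAlg A B M := ⟨a, 0, 0⟩

/-- The matrix whose only non-zero entry is `b : B`. -/
def inB (b : B) : TriAlg A B M := ⟨0, 0, b⟩

variable (A B M) in
/-- The idempotent `1_A`. -/
abbrev eA : TriAlg A B M := inA 1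

variable (A B M) in
/-- The idempotent `1_B`. -/
abbrev eB : TriAlg A B M := inB 1

/-- The ring morphism `π : E → B`. -/
def toB : TriAlg A B M →+* B where
  toFun x := x.b
  map_one' := rfl
  map_mul' _ _ := rfl
  map_zero' := rfl
  map_add' _ _ := rfl

@[simp] theorem inA_mul (a a' : A) : (inA a * inA a' : TriAlg A B M) = inA (a * a') := by
  ext <;> simp [inA]
@[simp] theorem inB_mul (b b' : B) : (inB b * inB b' : TriAlg A B M) = inB (b * b') := by
  ext <;> simp [inB]
theorem inA_add (a a' : A) : (inA (a + a') : TriAlg A B M) = inA a + inA a' := by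
  ext <;> simp [inA]
theorem inB_add (b b' : B) : (inB (b + b') : TriAlg A B M) = inB b + inB b' := by
  ext <;> simp [inB]
theorem inA_zero : (inA 0 : TriAlg A B M) = 0 := rfl
theorem inB_zero : (inB 0 : TriAlg A B M) = 0 := rfl

end

end TriAlg

/-! ## Hochschild homology -/

namespace Hochschild

section tensor

variable (k : Type u) [CommRing k] (C : Type u) [Ring C] [Algebra k C]

/-- Replacing one argument changes exactly one entry of the contracted tuple, linearly. -/
theorem exists_contractNth_update {n : ℕ} (j : Fin n) (m : Fin (n + 1) → C)
    (i : Fin (n + 1)) :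
    ∃ (p : Fin n) (l : C →ₗ[k] C), ∀ x : C,
      Fin.contractNth j.castSucc (· * ·) (Function.update m i x)
        = Function.update (Fin.contractNth j.castSucc (· * ·) m) p (l x) := by
  rcases lt_trichotomy i.val j.val with h | h | h
  · refine ⟨⟨i, by omega⟩, LinearMap.id, fun x => ?_⟩
    ext q
    simp only [Fin.contractNth, Function.update_apply, Fin.ext_iff, Fin.val_castSucc,
      Fin.val_succ, LinearMap.id_coe, id]
    split_ifs <;> first | rfl | omega
  · refine ⟨j, LinearMap.mulRight k (m j.succ), fun x => ?_⟩
    ext q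
    simp only [Fin.contractNth, Function.update_apply, Fin.ext_iff, Fin.val_castSucc,
      Fin.val_succ, LinearMap.mulRight_apply]
    split_ifs <;> first | rfl | omega | skip
    have : q = j := by ext; omega
    simp [this]
  · rcases eq_or_ne i.val (j.val + 1) with h' | h'
    · refine ⟨j, LinearMap.mulLeft k (m j.castSucc), fun x => ?_⟩
      ext q
      simp only [Fin.contractNth, Function.update_apply, Fin.ext_iff, Fin.val_castSucc,
        Fin.val_succ, LinearMap.mulLeft_apply]
      split_ifs <;> first | rfl | omega | skip
      have : q = j := by ext; omega
      simp [this]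
    · refine ⟨⟨i - 1, by omega⟩, LinearMap.id, fun x => ?_⟩
      ext q
      simp only [Fin.contractNth, Function.update_apply, Fin.ext_iff, Fin.val_castSucc,
        Fin.val_succ, LinearMap.id_coe, id]
      split_ifs <;> first | rfl | omega

/-- `c₀ ⊗ ⋯ ⊗ cₙ ↦ c₀ ⊗ ⋯ ⊗ cⱼ cⱼ₊₁ ⊗ ⋯ ⊗ cₙ`. -/
def contract {n : ℕ} (j : Fin n) : (⨂[k]^(n + 1) C) →ₗ[k] (⨂[k]^n C) :=
  PiTensorProduct.lift
    { toFun := fun m => PiTensorProduct.tprod k (Fin.contractNth j.castSucc (· * ·) m)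
      map_update_add' := fun {inst} m i x y => by
        have hi : inst = instDecidableEqFin (n + 1) := Subsingleton.elim _ _
        subst hi
        obtain ⟨p, l, h⟩ := exists_contractNth_update k C j m i
        simp only [h, map_add, MultilinearMap.map_update_add]
      map_update_smul' := fun {inst} m i c x => by
        have hi : inst = instDecidableEqFin (n + 1) := Subsingleton.elim _ _
        subst hi
        obtain ⟨p, l, h⟩ := exists_contractNth_update k C j m i
        simp only [h, map_smul, MultilinearMap.map_update_smul] }

@[simp] theorem contract_tprod {n : ℕ} (j : Fin n) (m : Fin (n + 1) → C) :
    contract k C j (PiTensorProduct.tprod k m)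
      = PiTensorProduct.tprod k (Fin.contractNth j.castSucc (· * ·) m) := by
  simp [contract]

end tensor

variable (k : Type u) [CommRing k] (C : Type u) [Ring C] [Algebra k C]
  (X : Type u) [AddCommGroup X] [Module k X] [Module C X] [Module Cᵐᵒᵖ X]
  [SMulCommClass C Cᵐᵒᵖ X] [IsScalarTower k C X] [IsScalarTower k Cᵐᵒᵖ X]

/-- The Hochschild chains `X ⊗ C^{⊗ n}`. -/
abbrev Chain (n : ℕ) : Type u := X ⊗[k] (⨂[k]^n C)

/-- The right action as a linear map `c ↦ (x ↦ x c)`. -/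
def rAct : C →ₗ[k] X →ₗ[k] X :=
  (Algebra.lsmul k k X : Cᵐᵒᵖ →ₐ[k] Module.End k X).toLinearMap ∘ₗ
    (opLinearEquiv k : C ≃ₗ[k] Cᵐᵒᵖ).toLinearMap

/-- The left action as a linear map `c ↦ (x ↦ c x)`. -/
def lAct : C →ₗ[k] X →ₗ[k] X :=
  (Algebra.lsmul k k X : C →ₐ[k] Module.End k X).toLinearMap

/-- `(f, t) ↦ (x ↦ f x ⊗ t)`. -/
def pairing (n : ℕ) : (X →ₗ[k] X) →ₗ[k] (⨂[k]^n C) →ₗ[k] (X →ₗ[k] Chain k C X n) :=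
  LinearMap.flip
    ((LinearMap.llcomp k X X (Chain k C X n)).comp (TensorProduct.mk k X (⨂[k]^n C)).flip)

@[simp] theorem pairing_apply (n : ℕ) (f : X →ₗ[k] X) (t : ⨂[k]^n C) (x : X) :
    pairing k C X n f t x = f x ⊗ₜ t := rfl

@[simp] theorem rAct_apply (c : C) (x : X) : rAct k C X c x = op c • x := rfl
@[simp] theorem lAct_apply (c : C) (x : X) : lAct k C X c x = c • x := rfl

/-- `x ⊗ c₀ ⊗ ⋯ ⊗ cₙ ↦ x c₀ ⊗ c₁ ⊗ ⋯ ⊗ cₙ`. -/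
def firstFace (n : ℕ) : Chain k C X (n + 1) →ₗ[k] Chain k C X n :=
  TensorProduct.lift (LinearMap.flip (PiTensorProduct.lift
    (LinearMap.uncurryLeft (M := fun _ : Fin (n + 1) => C)
      { toFun := fun c =>
          (pairing k C X n (rAct k C X c)).compMultilinearMap (PiTensorProduct.tprod k)
        map_add' := fun c d => by ext; simp
        map_smul' := fun r c => by ext; simp })))

@[simp] theorem firstFace_tmul_tprod (n : ℕ) (x : X) (m : Fin (n + 1) → C) :
    firstFace k C X n (x ⊗ₜ PiTensorProduct.tprod k m)
      = (op (m 0) • x) ⊗ₜ PiTensorProduct.tprod k (Fin.tail m) := by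
  simp [firstFace]

/-- `x ⊗ c₀ ⊗ ⋯ ⊗ cₙ ↦ cₙ x ⊗ c₀ ⊗ ⋯ ⊗ cₙ₋₁`. -/
def lastFace (n : ℕ) : Chain k C X (n + 1) →ₗ[k] Chain k C X n :=
  TensorProduct.lift (LinearMap.flip (PiTensorProduct.lift
    (MultilinearMap.uncurryRight (M := fun _ : Fin (n + 1) => C)
      (((LinearMap.lcomp k (X →ₗ[k] Chain k C X n) (lAct k C X)).comp
        (pairing k C X n).flip).compMultilinearMap (PiTensorProduct.tprod k)))))

@[simp] theorem lastFace_tmul_tprod (n : ℕ) (x : X) (m : Fin (n + 1) → C) :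
    lastFace k C X n (x ⊗ₜ PiTensorProduct.tprod k m)
      = (m (Fin.last n) • x) ⊗ₜ PiTensorProduct.tprod k (Fin.init m) := by
  simp [lastFace]

/-- The faces of the Hochschild complex, in their usual order. -/
def face (n : ℕ) (i : Fin (n + 2)) : Chain k C X (n + 1) →ₗ[k] Chain k C X n :=
  Fin.cases (firstFace k C X n)
    (Fin.lastCases (lastFace k C X n) (fun j => (contract k C j).lTensor X)) i

/-- The Hochschild boundary
`b(x ⊗ c₀ ⊗ ⋯ ⊗ cₙ) = x c₀ ⊗ c₁ ⊗ ⋯ ⊗ cₙ + ∑ⱼ (-1)^(j+1) x ⊗ ⋯ ⊗ cⱼ cⱼ₊₁ ⊗ ⋯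
  + (-1)^(n+1) cₙ x ⊗ c₀ ⊗ ⋯ ⊗ cₙ₋₁`. -/
def boundary (n : ℕ) : Chain k C X (n + 1) →ₗ[k] Chain k C X n :=
  ∑ i : Fin (n + 2), (-1 : ℤ) ^ (i : ℕ) • face k C X n i

/-- The coefficient of the `i`-th face of `x ⊗ c₀ ⊗ ⋯ ⊗ cₙ`. -/
def faceX {n : ℕ} (i : Fin (n + 2)) (m : Fin (n + 1) → C) (x : X) : X :=
  if i.val = 0 then op (m 0) • x else if i.val = n + 1 then m (Fin.last n) • x else x

/-- The remaining factors of the `i`-th face of `x ⊗ c₀ ⊗ ⋯ ⊗ cₙ`. -/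
def faceC {n : ℕ} (i : Fin (n + 2)) (m : Fin (n + 1) → C) (q : Fin n) : C :=
  if q.val + 1 < i.val then m q.castSucc
  else if q.val + 1 = i.val then m q.castSucc * m q.succ else m q.succ

theorem face_tmul_tprod (n : ℕ) (i : Fin (n + 2)) (x : X) (m : Fin (n + 1) → C) :
    face k C X n i (x ⊗ₜ PiTensorProduct.tprod k m)
      = faceX C X i m x ⊗ₜ PiTensorProduct.tprod k (faceC C i m) := by
  induction i using Fin.cases with
  | zero =>
    have : faceC C (0 : Fin (n + 2)) m = Fin.tail m := by
      ext q; simp [faceC, Fin.tail]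
    simp [face, faceX, this]
  | succ i =>
    induction i using Fin.lastCases with
    | last =>
      have : faceC C (Fin.last n).succ m = Fin.init m := by
        ext q; simp [faceC, Fin.init]
      simp only [face, Fin.cases_succ, Fin.lastCases_last, lastFace_tmul_tprod, this]
      simp [faceX]
    | cast j =>
      have : faceC C j.castSucc.succ m = Fin.contractNth j.castSucc (· * ·) m := by
        ext q; simp [faceC, Fin.contractNth]
      simp only [face, Fin.cases_succ, Fin.lastCases_castSucc, LinearMap.lTensor_tmul,
        contract_tprod, this]
      have hj : j.val ≠ n := by omega
      simp [faceX, hj]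

theorem chain_hom_ext {n : ℕ} {Z : Type u} [AddCommGroup Z] [Module k Z]
    {f g : Chain k C X n →ₗ[k] Z}
    (h : ∀ x m, f (x ⊗ₜ PiTensorProduct.tprod k m) = g (x ⊗ₜ PiTensorProduct.tprod k m)) :
    f = g := by
  apply TensorProduct.ext
  ext x m
  exact h x m

theorem face_comp_face (n : ℕ) (i j : Fin (n + 2)) (hij : i ≤ j) :
    (face k C X n i).comp (face k C X (n + 1) j.succ)
      = (face k C X n j).comp (face k C X (n + 1) i.castSucc) := by
  apply chain_hom_ext
  intro x m
  simp only [LinearMap.comp_apply, face_tmul_tprod]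
  have hij' : i.val ≤ j.val := hij
  have hi := i.isLt
  have hj := j.isLt
  obtain ⟨f, hf⟩ : ∃ f : ℕ → C, ∀ q : Fin (n + 2), m q = f q.val :=
    ⟨fun t => if h : t < n + 2 then m ⟨t, h⟩ else 0, fun q => by simp⟩
  congr 1
  · have h0 := fun c d => smul_comm (c : C) (op d : Cᵐᵒᵖ) x
    have h1 := fun c d => mul_smul (c : C) d x
    have h2 : ∀ c d : C, op (c * d) • x = op d • op c • x := fun c d => by
      rw [op_mul, mul_smul]
    simp only [faceX, faceC, hf, Fin.val_succ, Fin.val_castSucc, Fin.val_last, Fin.val_zero]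
    generalize i.val = i at *
    generalize j.val = j at *
    clear hf hij
    grind
  · congr 1
    ext q
    simp only [faceC, hf, Fin.val_succ, Fin.val_castSucc]
    generalize i.val = i at *
    generalize j.val = j at *
    have h0 := fun c d e : C => mul_assoc c d e
    clear hf hij
    grind

theorem boundary_comp_boundary (n : ℕ) :
    (boundary k C X n).comp (boundary k C X (n + 1)) = 0 := by
  have key : (boundary k C X n).comp (boundary k C X (n + 1))
      = ∑ p : Fin (n + 2) × Fin (n + 3), ((-1 : ℤ) ^ (p.1 : ℕ) * (-1 : ℤ) ^ (p.2 : ℕ)) •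
        (face k C X n p.1).comp (face k C X (n + 1) p.2) := by
    refine LinearMap.ext fun t => ?_
    rw [Fintype.sum_prod_type]
    simp only [boundary, LinearMap.comp_apply, LinearMap.sum_apply, LinearMap.smul_apply,
      map_sum, map_zsmul, Finset.smul_sum, smul_smul]
    rw [Finset.sum_comm]
    exact Finset.sum_congr rfl fun i _ => Finset.sum_congr rfl fun j _ => by rw [mul_comm]
  rw [key]
  let S : Finset (Fin (n + 2) × Fin (n + 3)) :=
    Finset.univ.filter fun p => (p.2 : ℕ) ≤ (p.1 : ℕ)
  rw [← Finset.sum_add_sum_compl S, ← eq_neg_iff_add_eq_zero, ← Finset.sum_neg_distrib]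
  refine Finset.sum_bij (fun p hp => (Fin.castLT p.2
    (lt_of_le_of_lt (Finset.mem_filter.mp hp).right p.1.isLt), p.1.succ)) ?_ ?_ ?_ ?_
  · intro p hp
    simp only [S, Finset.compl_filter, Finset.mem_filter_univ, Fin.val_succ,
      Fin.val_castLT] at hp ⊢
    omega
  · rintro ⟨i, j⟩ hp ⟨i', j'⟩ hp' h
    simp only [Prod.mk.injEq, Fin.ext_iff, Fin.val_succ, Fin.val_castLT] at h ⊢
    omega
  · rintro ⟨i', j'⟩ hp
    simp only [S, Finset.compl_filter, Finset.mem_filter_univ, not_le] at hp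
    have hj := j'.isLt
    refine ⟨(⟨j'.val - 1, by omega⟩, i'.castSucc), ?_, ?_⟩
    · simp only [S, Finset.mem_filter_univ, Fin.val_castSucc]
      omega
    · simp only [Prod.mk.injEq, Fin.ext_iff, Fin.val_succ, Fin.val_castLT, Fin.val_castSucc,
        true_and]
      omega
  · rintro ⟨i, j⟩ hp
    simp only [S, Finset.mem_filter_univ] at hp
    have h := face_comp_face k C X n (j.castLT (lt_of_le_of_lt hp i.isLt)) i hp
    rw [Fin.castSucc_castLT] at h
    simp only [h, Fin.val_succ, Fin.val_castLT, ← neg_smul]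
    congr 1
    ring

/-- The Hochschild chain complex of `C` with coefficients in the `C`-bimodule `X`. -/
def complex : ChainComplex (ModuleCat.{u} k) ℕ :=
  ChainComplex.of (fun n => ModuleCat.of k (Chain k C X n))
    (fun n => ModuleCat.ofHom (boundary k C X n))
    (fun n => by
      rw [← ModuleCat.ofHom_comp, boundary_comp_boundary]
      rfl)

/-- Hochschild homology `H_n(C, X)`. -/
abbrev homology (n : ℕ) : ModuleCat.{u} k := (complex k C X).homology n

end Hochschild

/-! ## Relative projective resolutions and relative `Tor` -/

section relative

variable (k : Type u) [CommRing k] (R : Type u) [Ring R] [Algebra k R]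

/-- `P` is projective relative to the `R`-linear epimorphisms which split as `k`-linear maps. -/
def IsRelProjective (P : Type u) [AddCommGroup P] [Module R P] : Prop :=
  ∀ (U V : Type u) [AddCommGroup U] [AddCommGroup V] [Module k U] [Module k V]
    [Module R U] [Module R V] [IsScalarTower k R U] [IsScalarTower k R V]
    (f : U →ₗ[R] V) (s : V →ₗ[k] U), (∀ v, f (s v) = v) →
    ∀ g : P →ₗ[R] V, ∃ h : P →ₗ[R] U, f.comp h = g

/-- A projective resolution `⋯ → P 1 → P 0 → Y → 0` of the `R`-module `Y`, relative to the
`R`-linear epimorphisms which split as `k`-linear maps: all `P n` are relatively projective and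
the augmented complex is contractible as a complex of `k`-modules. -/
structure RelProjResolution (Y : Type u) [AddCommGroup Y] [Module k Y] [Module R Y]
    [IsScalarTower k R Y] where
  P : ℕ → Type u
  [addCommGroup : ∀ n, AddCommGroup (P n)]
  [moduleBase : ∀ n, Module k (P n)]
  [module : ∀ n, Module R (P n)]
  [isScalarTower : ∀ n, IsScalarTower k R (P n)]
  d : ∀ n, P (n + 1) →ₗ[R] P n
  ε : P 0 →ₗ[R] Y
  ε_comp_d : ε.comp (d 0) = 0
  d_comp_d : ∀ n, (d n).comp (d (n + 1)) = 0
  relProjective : ∀ n, IsRelProjective k R (P n)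
  contractible : ∃ (s' : Y →ₗ[k] P 0) (s : ∀ n, P n →ₗ[k] P (n + 1)),
    (∀ y, ε (s' y) = y) ∧ (∀ x, d 0 (s 0 x) + s' (ε x) = x) ∧
      ∀ n x, d (n + 1) (s (n + 1) x) + s n (d n x) = x

attribute [instance] RelProjResolution.addCommGroup RelProjResolution.moduleBase
  RelProjResolution.module RelProjResolution.isScalarTower

section balanced

variable (N : Type u) [AddCommGroup N] [Module k N] [Module Rᵐᵒᵖ N] [IsScalarTower k Rᵐᵒᵖ N]

/-- The submodule of `N ⊗[k] P` generated by the elements `n r ⊗ p - n ⊗ r p`. -/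
def balancedRel (P : Type u) [AddCommGroup P] [Module k P] [Module R P] :
    Submodule k (N ⊗[k] P) :=
  Submodule.span k {t | ∃ (n : N) (r : R) (p : P), t = (op r • n) ⊗ₜ p - n ⊗ₜ (r • p)}

/-- The tensor product `N ⊗_R P` of a right and a left module over the `k`-algebra `R`. -/
abbrev BalancedTensor (P : Type u) [AddCommGroup P] [Module k P] [Module R P] : Type u :=
  (N ⊗[k] P) ⧸ balancedRel k R N P

variable {P Q : Type u} [AddCommGroup P] [Module k P] [Module R P] [IsScalarTower k R P]
  [AddCommGroup Q] [Module k Q] [Module R Q] [IsScalarTower k R Q]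

/-- The map `N ⊗_R P → N ⊗_R Q` induced by an `R`-linear map `P → Q`. -/
def BalancedTensor.map (f : P →ₗ[R] Q) : BalancedTensor k R N P →ₗ[k] BalancedTensor k R N Q :=
  Submodule.mapQ _ _ ((f.restrictScalars k).lTensor N) (by
    rw [balancedRel, Submodule.span_le]
    rintro _ ⟨n, r, p, rfl⟩
    refine Submodule.subset_span ⟨n, r, f p, ?_⟩
    simp)

variable {Y : Type u} [AddCommGroup Y] [Module k Y] [Module R Y] [IsScalarTower k R Y]

variable {k R} in
/-- The complex `N ⊗_R P_*`. -/
def RelProjResolution.torComplex (P : RelProjResolution k R Y) :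
    ChainComplex (ModuleCat.{u} k) ℕ :=
  ChainComplex.of (fun n => ModuleCat.of k (BalancedTensor k R N (P.P n)))
    (fun n => ModuleCat.ofHom (BalancedTensor.map k R N (P.d n)))
    (fun n => by
      rw [← ModuleCat.ofHom_comp]
      have h : (BalancedTensor.map k R N (P.d n)).comp (BalancedTensor.map k R N (P.d (n + 1)))
          = 0 := by
        apply Submodule.linearMap_qext
        apply TensorProduct.ext'
        intro x p
        have := LinearMap.congr_fun (P.d_comp_d n) p
        simp only [LinearMap.comp_apply, LinearMap.zero_apply] at this
        simp [BalancedTensor.map, this]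
      rw [h]
      rfl)

variable {k R} in
/-- The relative `Tor_n^{R,k}(Y, N)`, computed from the relative projective resolution `P` of the
left `R`-module `Y`; here `N` is a right `R`-module. -/
abbrev RelProjResolution.tor (P : RelProjResolution k R Y) (n : ℕ) : ModuleCat.{u} k :=
  (P.torComplex N).homology n

end balanced

/-! Every module has a relative projective resolution. -/

theorem isRelProjective_tensor (V : Type u) [AddCommGroup V] [Module k V] :
    IsRelProjective k R (R ⊗[k] V) := by
  intro U W _ _ _ _ _ _ _ _ f s hs g
  refine ⟨TensorProduct.AlgebraTensorModule.lift
    { toFun := fun r => r • (s ∘ₗ g.restrictScalars k ∘ₗ TensorProduct.mk k R V 1)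
      map_add' := fun a b => add_smul _ _ _
      map_smul' := fun a b => mul_smul _ _ _ }, ?_⟩
  ext v
  simp [hs]

/-- An `R`-module together with a compatible `k`-module structure. -/
structure RelMod where
  carrier : Type u
  [addCommGroup : AddCommGroup carrier]
  [moduleBase : Module k carrier]
  [module : Module R carrier]
  [isScalarTower : IsScalarTower k R carrier]

attribute [instance] RelMod.addCommGroup RelMod.moduleBase RelMod.module RelMod.isScalarTower

variable {k R}

/-- The action `R ⊗[k] V → V`. -/
def RelMod.act (V : RelMod k R) : R ⊗[k] V.carrier →ₗ[R] V.carrier :=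
  TensorProduct.AlgebraTensorModule.lift
    { toFun := fun r => r • (LinearMap.id : V.carrier →ₗ[k] V.carrier)
      map_add' := fun a b => add_smul _ _ _
      map_smul' := fun a b => mul_smul _ _ _ }

/-- The kernel of the action. -/
def RelMod.ker (V : RelMod k R) : RelMod k R where
  carrier := LinearMap.ker (V.act)

/-- The iterated kernels. -/
def RelMod.syzygy (V : RelMod k R) : ℕ → RelMod k R
  | 0 => V
  | n + 1 => (RelMod.syzygy V n).ker

/-- `x ↦ x - 1 ⊗ act x`, from `R ⊗[k] V` to the kernel of the action. -/
def RelMod.retr (V : RelMod k R) : R ⊗[k] V.carrier →ₗ[k] V.ker.carrier :=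
  LinearMap.codRestrict ((LinearMap.ker V.act).restrictScalars k)
    (LinearMap.id - (TensorProduct.mk k R V.carrier 1).comp (V.act.restrictScalars k))
    (fun x => by simp [RelMod.act])

variable (k R) in
theorem RelProjResolution.nonempty (Y : Type u) [AddCommGroup Y] [Module k Y] [Module R Y]
    [IsScalarTower k R Y] :
    Nonempty (RelProjResolution k R Y) := by
  let V : ℕ → RelMod k R := RelMod.syzygy ⟨Y⟩
  let inc : ∀ n, (V (n + 1)).carrier →ₗ[R] R ⊗[k] (V n).carrier :=
    fun n => (LinearMap.ker (V n).act).subtype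
  have hinc : ∀ n x, (V n).act (inc n x) = 0 := fun n x => x.2
  have hact : ∀ n (x : (V n).carrier), (V n).act (1 ⊗ₜ x) = x := fun n x => by
    simp [RelMod.act]
  let r : ∀ n, R ⊗[k] (V n).carrier →ₗ[k] (V (n + 1)).carrier := fun n => (V n).retr
  have hr : ∀ n x, inc n (r n x) = x - 1 ⊗ₜ (V n).act x := fun n x => rfl
  have hinj : ∀ n, Function.Injective (inc n) := fun n => Subtype.val_injective
  refine ⟨{
    P := fun n => R ⊗[k] (V n).carrier
    d := fun n => (inc n).comp (V (n + 1)).act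
    ε := (V 0).act
    ε_comp_d := LinearMap.ext fun x => hinc 0 _
    d_comp_d := fun n => LinearMap.ext fun x => by
      change inc n ((V (n + 1)).act (inc (n + 1) _)) = 0
      rw [hinc, map_zero]
    relProjective := fun n => isRelProjective_tensor k R _
    contractible := ⟨TensorProduct.mk k R (V 0).carrier 1,
      fun n => (TensorProduct.mk k R (V (n + 1)).carrier 1).comp (r n), ?_, ?_, ?_⟩ }⟩
  · intro y
    exact hact 0 y
  · intro x
    simp only [LinearMap.comp_apply, TensorProduct.mk_apply, hact, hr]
    exact sub_add_cancel _ _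
  · intro n x
    have h : r n (inc n ((V (n + 1)).act x)) = (V (n + 1)).act x := by
      apply hinj
      rw [hr, hinc]
      simp
    simp [hact, hr, h]

end relative

/-! ## The bimodules attached to a triangular algebra -/

section triangular

variable (k : Type u) [CommRing k] (A B M : Type u) [Ring A] [Ring B] [Algebra k A] [Algebra k B]
  [AddCommGroup M] [Module k M] [Module A M] [Module Bᵐᵒᵖ M] [SMulCommClass A Bᵐᵒᵖ M]
  [IsScalarTower k A M] [IsScalarTower k Bᵐᵒᵖ M]

section BE

/-- `B_E`: the ring `B`, considered as an `E`-bimodule via `π`; only the induced structure of a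
left `E ⊗ B^op`-module is needed. -/
def BE (_A B _M : Type u) : Type u := B

instance : AddCommGroup (BE A B M) := inferInstanceAs (AddCommGroup B)
instance : Module k (BE A B M) := inferInstanceAs (Module k B)
instance : Module Bᵐᵒᵖ (BE A B M) := inferInstanceAs (Module Bᵐᵒᵖ B)
instance : Module (TriAlg A B M) (BE A B M) := Module.compHom B (TriAlg.toB (A := A) (M := M))
instance : IsScalarTower k Bᵐᵒᵖ (BE A B M) := inferInstanceAs (IsScalarTower k Bᵐᵒᵖ B)
instance : IsScalarTower k (TriAlg A B M) (BE A B M) :=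
  ⟨fun c e y => smul_mul_assoc c e.b (show B from y)⟩
instance : SMulCommClass (TriAlg A B M) Bᵐᵒᵖ (BE A B M) :=
  ⟨fun e b y => (mul_assoc e.b (show B from y) b.unop).symm⟩

/-- The left `E ⊗ B^op`-module structure of `B_E`: `(e ⊗ b) y = π(e) y b`. -/
instance : Module (TriAlg A B M ⊗[k] Bᵐᵒᵖ) (BE A B M) := TensorProduct.Algebra.module

theorem BE.tmul_smul (e : TriAlg A B M) (b : B) (y : B) :
    (e ⊗ₜ[k] op b) • (show BE A B M from y) = (show BE A B M from e.b * y * b) := by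
  rw [TensorProduct.Algebra.smul_def]
  exact (mul_assoc e.b y b).symm

instance : IsScalarTower k (TriAlg A B M ⊗[k] Bᵐᵒᵖ) (BE A B M) :=
  ⟨fun c t y => by
    induction t using TensorProduct.induction_on with
    | zero =>
      have h := zero_smul (TriAlg A B M ⊗[k] Bᵐᵒᵖ) y
      rw [smul_zero]
      exact h.trans ((smul_zero c).symm.trans (congrArg (c • ·) h.symm))
    | add s t hs ht => simp only [smul_add, add_smul, hs, ht]
    | tmul e b =>
      rw [TensorProduct.smul_tmul', TensorProduct.Algebra.smul_def,
        TensorProduct.Algebra.smul_def, smul_assoc]⟩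

end BE

variable (X : Type u) [AddCommGroup X] [Module k X] [Module (TriAlg A B M) X]
  [Module (TriAlg A B M)ᵐᵒᵖ X] [SMulCommClass (TriAlg A B M) (TriAlg A B M)ᵐᵒᵖ X]
  [IsScalarTower k (TriAlg A B M) X] [IsScalarTower k (TriAlg A B M)ᵐᵒᵖ X]

/-- `1_A X 1_A`, as a `k`-submodule of `X`. -/
def cornerAA : Submodule k X :=
  LinearMap.range (Hochschild.rAct k (TriAlg A B M) X (TriAlg.eA A B M) ∘ₗ
    Hochschild.lAct k (TriAlg A B M) X (TriAlg.eA A B M))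

/-- `1_B X`, as a `k`-submodule of `X`. -/
def cornerB : Submodule k X :=
  LinearMap.range (Hochschild.lAct k (TriAlg A B M) X (TriAlg.eB A B M))

section AA

/-- `X_AA = 1_A X 1_A`, as an `A`-bimodule. -/
def XAA : Type u := cornerAA k A B M X

instance : AddCommGroup (XAA k A B M X) := inferInstanceAs (AddCommGroup (cornerAA k A B M X))
instance : Module k (XAA k A B M X) := inferInstanceAs (Module k (cornerAA k A B M X))

/-- The inclusion `X_AA → X`. -/
def XAA.incl : XAA k A B M X →ₗ[k] X := (cornerAA k A B M X).subtype

theorem XAA.incl_injective : Function.Injective (XAA.incl k A B M X) := Subtype.val_injective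

theorem cornerAA_lsmul (a : A) (x : X) (hx : x ∈ cornerAA k A B M X) :
    (TriAlg.inA a : TriAlg A B M) • x ∈ cornerAA k A B M X := by
  obtain ⟨y, rfl⟩ := hx
  refine ⟨(TriAlg.inA a : TriAlg A B M) • y, ?_⟩
  simp only [LinearMap.comp_apply, Hochschild.rAct_apply, Hochschild.lAct_apply, TriAlg.eA,
    smul_comm (TriAlg.inA a : TriAlg A B M) (op (TriAlg.inA 1 : TriAlg A B M)), ← mul_smul,
    TriAlg.inA_mul, one_mul, mul_one]

theorem cornerAA_rsmul (a : A) (x : X) (hx : x ∈ cornerAA k A B M X) :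
    op (TriAlg.inA a : TriAlg A B M) • x ∈ cornerAA k A B M X := by
  obtain ⟨y, rfl⟩ := hx
  refine ⟨op (TriAlg.inA a : TriAlg A B M) • y, ?_⟩
  simp only [LinearMap.comp_apply, Hochschild.rAct_apply, Hochschild.lAct_apply, TriAlg.eA,
    smul_comm (TriAlg.inA 1 : TriAlg A B M) (op (TriAlg.inA a : TriAlg A B M)), ← mul_smul,
    ← op_mul, TriAlg.inA_mul, one_mul, mul_one]

theorem XAA.one_lsmul (x : XAA k A B M X) :
    (TriAlg.eA A B M) • XAA.incl k A B M X x = XAA.incl k A B M X x := by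
  obtain ⟨_, y, rfl⟩ := x
  change TriAlg.eA A B M • op (TriAlg.eA A B M) • TriAlg.eA A B M • y
    = op (TriAlg.eA A B M) • TriAlg.eA A B M • y
  rw [smul_comm, ← mul_smul (TriAlg.eA A B M), TriAlg.inA_mul, one_mul]

theorem XAA.one_rsmul (x : XAA k A B M X) :
    op (TriAlg.eA A B M) • XAA.incl k A B M X x = XAA.incl k A B M X x := by
  obtain ⟨_, y, rfl⟩ := x
  change op (TriAlg.eA A B M) • op (TriAlg.eA A B M) • TriAlg.eA A B M • y
    = op (TriAlg.eA A B M) • TriAlg.eA A B M • y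
  rw [← mul_smul (op (TriAlg.eA A B M)), ← op_mul, TriAlg.inA_mul, one_mul]

instance : SMul A (XAA k A B M X) :=
  ⟨fun a x => ⟨(TriAlg.inA a : TriAlg A B M) • x.1, cornerAA_lsmul k A B M X a x.1 x.2⟩⟩

instance : SMul Aᵐᵒᵖ (XAA k A B M X) :=
  ⟨fun a x =>
    ⟨op (TriAlg.inA a.unop : TriAlg A B M) • x.1, cornerAA_rsmul k A B M X a.unop x.1 x.2⟩⟩

theorem XAA.incl_lsmul (a : A) (x : XAA k A B M X) :
    XAA.incl k A B M X (a • x) = (TriAlg.inA a : TriAlg A B M) • XAA.incl k A B M X x := rfl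

theorem XAA.incl_rsmul (a : Aᵐᵒᵖ) (x : XAA k A B M X) :
    XAA.incl k A B M X (a • x)
      = op (TriAlg.inA a.unop : TriAlg A B M) • XAA.incl k A B M X x := rfl

instance : Module A (XAA k A B M X) where
  one_smul x := XAA.incl_injective k A B M X (XAA.one_lsmul k A B M X x)
  mul_smul a b x := XAA.incl_injective k A B M X (by
    simp only [XAA.incl_lsmul, ← mul_smul, TriAlg.inA_mul])
  smul_zero a := XAA.incl_injective k A B M X (by
    simp only [XAA.incl_lsmul, map_zero, smul_zero])
  smul_add a x y := XAA.incl_injective k A B M X (by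
    simp only [XAA.incl_lsmul, map_add, smul_add])
  add_smul a b x := XAA.incl_injective k A B M X (by
    simp only [XAA.incl_lsmul, map_add, TriAlg.inA_add, add_smul])
  zero_smul x := XAA.incl_injective k A B M X (by
    simp only [XAA.incl_lsmul, map_zero, TriAlg.inA_zero, zero_smul])

instance : Module Aᵐᵒᵖ (XAA k A B M X) where
  one_smul x := XAA.incl_injective k A B M X (XAA.one_rsmul k A B M X x)
  mul_smul a b x := XAA.incl_injective k A B M X (by
    simp only [XAA.incl_rsmul, ← mul_smul, ← op_mul, TriAlg.inA_mul, unop_mul])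
  smul_zero a := XAA.incl_injective k A B M X (by
    simp only [XAA.incl_rsmul, map_zero, smul_zero])
  smul_add a x y := XAA.incl_injective k A B M X (by
    simp only [XAA.incl_rsmul, map_add, smul_add])
  add_smul a b x := XAA.incl_injective k A B M X (by
    simp only [XAA.incl_rsmul, map_add, unop_add, TriAlg.inA_add, op_add, add_smul])
  zero_smul x := XAA.incl_injective k A B M X (by
    simp only [XAA.incl_rsmul, map_zero, unop_zero, TriAlg.inA_zero, op_zero, zero_smul])

instance : SMulCommClass A Aᵐᵒᵖ (XAA k A B M X) :=
  ⟨fun a b x => XAA.incl_injective k A B M X (by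
    simp only [XAA.incl_lsmul, XAA.incl_rsmul]
    rw [smul_comm])⟩

instance : IsScalarTower k A (XAA k A B M X) :=
  ⟨fun c a x => XAA.incl_injective k A B M X (by
    have h : (TriAlg.inA (c • a) : TriAlg A B M) = c • TriAlg.inA a := by
      ext <;> simp [TriAlg.inA]
    simp only [XAA.incl_lsmul, map_smul, h, smul_assoc])⟩

instance : IsScalarTower k Aᵐᵒᵖ (XAA k A B M X) :=
  ⟨fun c a x => XAA.incl_injective k A B M X (by
    have h : (TriAlg.inA (c • a.unop) : TriAlg A B M) = c • TriAlg.inA a.unop := by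
      ext <;> simp [TriAlg.inA]
    simp only [XAA.incl_rsmul, map_smul, unop_smul, h, op_smul, smul_assoc])⟩

end AA

section BX

/-- `1_B X`, as a `(B, E)`-bimodule and as a right `E ⊗ B^op`-module. -/
def BX : Type u := cornerB k A B M X

instance : AddCommGroup (BX k A B M X) := inferInstanceAs (AddCommGroup (cornerB k A B M X))
instance : Module k (BX k A B M X) := inferInstanceAs (Module k (cornerB k A B M X))

/-- The inclusion `1_B X → X`. -/
def BX.incl : BX k A B M X →ₗ[k] X := (cornerB k A B M X).subtype

theorem BX.incl_injective : Function.Injective (BX.incl k A B M X) := Subtype.val_injective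

theorem cornerB_lsmul (b : B) (x : X) (hx : x ∈ cornerB k A B M X) :
    (TriAlg.inB b : TriAlg A B M) • x ∈ cornerB k A B M X := by
  obtain ⟨y, rfl⟩ := hx
  refine ⟨(TriAlg.inB b : TriAlg A B M) • y, ?_⟩
  simp only [Hochschild.lAct_apply, TriAlg.eB, ← mul_smul, TriAlg.inB_mul, one_mul, mul_one]

theorem cornerB_rsmul (e : (TriAlg A B M)ᵐᵒᵖ) (x : X) (hx : x ∈ cornerB k A B M X) :
    e • x ∈ cornerB k A B M X := by
  obtain ⟨y, rfl⟩ := hx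
  exact ⟨e • y, smul_comm _ _ _⟩

theorem BX.one_lsmul (x : BX k A B M X) :
    (TriAlg.eB A B M) • BX.incl k A B M X x = BX.incl k A B M X x := by
  obtain ⟨_, y, rfl⟩ := x
  change TriAlg.eB A B M • TriAlg.eB A B M • y = TriAlg.eB A B M • y
  rw [← mul_smul, TriAlg.inB_mul, one_mul]

instance : SMul B (BX k A B M X) :=
  ⟨fun b x => ⟨(TriAlg.inB b : TriAlg A B M) • x.1, cornerB_lsmul k A B M X b x.1 x.2⟩⟩

instance : SMul (TriAlg A B M)ᵐᵒᵖ (BX k A B M X) :=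
  ⟨fun e x => ⟨e • x.1, cornerB_rsmul k A B M X e x.1 x.2⟩⟩

theorem BX.incl_lsmul (b : B) (x : BX k A B M X) :
    BX.incl k A B M X (b • x) = (TriAlg.inB b : TriAlg A B M) • BX.incl k A B M X x := rfl

theorem BX.incl_rsmul (e : (TriAlg A B M)ᵐᵒᵖ) (x : BX k A B M X) :
    BX.incl k A B M X (e • x) = e • BX.incl k A B M X x := rfl

instance : Module B (BX k A B M X) where
  one_smul x := BX.incl_injective k A B M X (BX.one_lsmul k A B M X x)
  mul_smul a b x := BX.incl_injective k A B M X (by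
    simp only [BX.incl_lsmul, ← mul_smul, TriAlg.inB_mul])
  smul_zero a := BX.incl_injective k A B M X (by
    simp only [BX.incl_lsmul, map_zero, smul_zero])
  smul_add a x y := BX.incl_injective k A B M X (by
    simp only [BX.incl_lsmul, map_add, smul_add])
  add_smul a b x := BX.incl_injective k A B M X (by
    simp only [BX.incl_lsmul, map_add, TriAlg.inB_add, add_smul])
  zero_smul x := BX.incl_injective k A B M X (by
    simp only [BX.incl_lsmul, map_zero, TriAlg.inB_zero, zero_smul])

instance : Module (TriAlg A B M)ᵐᵒᵖ (BX k A B M X) where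
  one_smul x := BX.incl_injective k A B M X (one_smul _ _)
  mul_smul a b x := BX.incl_injective k A B M X (mul_smul _ _ _)
  smul_zero a := BX.incl_injective k A B M X (smul_zero _)
  smul_add a x y := BX.incl_injective k A B M X (smul_add _ _ _)
  add_smul a b x := BX.incl_injective k A B M X (add_smul _ _ _)
  zero_smul x := BX.incl_injective k A B M X (zero_smul _ _)

instance : SMulCommClass (TriAlg A B M)ᵐᵒᵖ B (BX k A B M X) :=
  ⟨fun a b x => BX.incl_injective k A B M X (by
    simp only [BX.incl_lsmul, BX.incl_rsmul]
    exact (smul_comm _ _ _).symm)⟩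

instance : IsScalarTower k B (BX k A B M X) :=
  ⟨fun c a x => BX.incl_injective k A B M X (by
    have h : (TriAlg.inB (c • a) : TriAlg A B M) = c • TriAlg.inB a := by
      ext <;> simp [TriAlg.inB]
    simp only [BX.incl_lsmul, map_smul, h, smul_assoc])⟩

instance : IsScalarTower k (TriAlg A B M)ᵐᵒᵖ (BX k A B M X) :=
  ⟨fun c a x => BX.incl_injective k A B M X (by
    simp only [BX.incl_rsmul, map_smul, smul_assoc])⟩

/-- The action of `(E ⊗ B^op)^op` on `1_B X`. -/
def BX.actHom : (TriAlg A B M ⊗[k] Bᵐᵒᵖ)ᵐᵒᵖ →ₐ[k] Module.End k (BX k A B M X) :=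
  (Algebra.TensorProduct.lift
    (Algebra.lsmul k k (BX k A B M X) : (TriAlg A B M)ᵐᵒᵖ →ₐ[k] Module.End k (BX k A B M X))
    ((Algebra.lsmul k k (BX k A B M X) : B →ₐ[k] Module.End k (BX k A B M X)).comp
      (AlgEquiv.opOp k B).symm.toAlgHom)
    (fun e b => LinearMap.ext fun x => smul_comm e b.unop.unop x)).comp
  (Algebra.TensorProduct.opAlgEquiv k k (TriAlg A B M) Bᵐᵒᵖ).symm.toAlgHom

/-- The right `E ⊗ B^op`-module structure of `1_B X`: `x (e ⊗ b) = b x e`. -/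
instance : Module (TriAlg A B M ⊗[k] Bᵐᵒᵖ)ᵐᵒᵖ (BX k A B M X) :=
  Module.compHom (BX k A B M X) (BX.actHom k A B M X).toRingHom

theorem BX.op_tmul_smul (e : TriAlg A B M) (b : B) (x : BX k A B M X) :
    op (e ⊗ₜ[k] op b) • x = b • op e • x := by
  change BX.actHom k A B M X (op (e ⊗ₜ[k] op b)) x = _
  rw [← smul_comm]
  simp only [BX.actHom, AlgHom.comp_apply]
  exact congrArg (fun f : Module.End k (BX k A B M X) => f x)
    (Algebra.TensorProduct.lift_tmul _ _ _ (op e) (op (op b)))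

instance : IsScalarTower k (TriAlg A B M ⊗[k] Bᵐᵒᵖ)ᵐᵒᵖ (BX k A B M X) :=
  ⟨fun c t x => by
    change BX.actHom k A B M X (c • t) x = c • BX.actHom k A B M X t x
    rw [map_smul]
    rfl⟩

end BX

end triangular

end

/-! The lower left corner of E vanishes, so E 1_A = 1_A E 1_A = A and 1_B E = B. Hence 1_A X is
stable under left multiplication by E, and on the quotient X / 1_A X ≅ 1_B X the left action factors
through π. This gives an exact sequence of E-bimodules 0 → 1_A X → X → 1_B X → 0, split over k by
the two idempotents. The splitting survives tensoring with E^{⊗n}, so the Hochschild complexes form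
a short exact sequence (`cornerShortComplex_shortExact`) and have a long exact homology sequence. It
remains to identify the two outer terms.

H_n(E, 1_A X) ≅ H_n(A, X_AA): the corner inclusion and the projection (e, x) ↦ (e.a, x 1_A) compose
in one order to the identity, in the other to right multiplication of every factor by 1_A. The
latter is homotopic to the identity through a simplicial homotopy that inserts 1_A; it needs only
1_A c 1_A = c 1_A and 1_A x = x (`Hochschild.homologyMap_compress`).

H_n(E, 1_B X) ≅ Tor_n(B_E, 1_B X): the Hochschild complex of E with coefficients in E ⊗ B is a
relatively free resolution of B_E (`barResolution`), and 1_B X ⊗_{E ⊗ B^op} - turns it into the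
Hochschild complex of 1_B X (`barTorComplexIso`). The given resolution is arbitrary, so the
comparison theorem for relative resolutions is needed as well (`RelProjResolution.torIso`). -/

noncomputable section

open CategoryTheory

set_option linter.unusedSectionVars false

/-! ## Chain homotopies -/

/-- Chain maps which are homotopic through a sequence of maps `C_n ⟶ D_{n+1}` induce the same
map on homology. -/
theorem ChainComplex.homologyMap_eq_of_homotopy {V : Type*} [Category V] [Preadditive V]
    [CategoryWithHomology V] {C D : ChainComplex V ℕ} (f g : C ⟶ D)
    (h : ∀ n, C.X n ⟶ D.X (n + 1)) (h_zero : f.f 0 = h 0 ≫ D.d 1 0 + g.f 0)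
    (h_succ : ∀ n, f.f (n + 1)
      = C.d (n + 1) n ≫ h n + h (n + 1) ≫ D.d (n + 2) (n + 1) + g.f (n + 1)) (n : ℕ) :
    HomologicalComplex.homologyMap f n = HomologicalComplex.homologyMap g n := by
  refine Homotopy.homologyMap_eq (f := f) (g := g)
    { hom := fun i j => if hij : i + 1 = j then h i ≫ eqToHom (by rw [hij]) else 0
      zero := fun i j hij => dif_neg hij
      comm := fun i => ?_ } n
  cases i with
  | zero =>
    rw [prevD_eq (j' := 1) (w := by simp), dNext_eq_zero _ _ (by simp), zero_add]
    simp [h_zero]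
  | succ i =>
    rw [dNext_eq (i' := i) (w := by simp), prevD_eq (j' := i + 2) (w := by simp)]
    simp [h_succ]

/-- The cancellation of signs which turns a simplicial homotopy into a chain homotopy: `F i j`
stands for the `i`-th face of the `j`-th homotopy operator, `K i j` for the `j`-th homotopy operator
after the `i`-th face. -/
theorem alternating_sum_simplicial_homotopy {G : Type*} [AddCommGroup G] (N : ℕ)
    (F K : ℕ → ℕ → G)
    (h_lt : ∀ i j, i ≤ j → j < N → F i (j + 1) = K i j)
    (h_gt : ∀ i j, j < i → i ≤ N → F (i + 1) j = K i j)
    (h_eq : ∀ j, j < N → F (j + 1) (j + 1) = F (j + 1) j) :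
    ∑ j ∈ Finset.range N, ∑ i ∈ Finset.range (N + 1), (-1 : ℤ) ^ (i + j) • K i j
      + ∑ j ∈ Finset.range (N + 1), ∑ i ∈ Finset.range (N + 2), (-1 : ℤ) ^ (i + j) • F i j
      = F 0 0 - F (N + 1) N := by
  -- Column j of K is cut at the diagonal into `low` (i ≤ j) and `high` (i > j). Column j of F is
  -- cut into `front` (i < j), the two rows j and j + 1, and the rows from j + 2 on, which reproduce
  -- `high` with the opposite sign.
  let low : ℕ → G := fun j => ∑ i ∈ Finset.range (j + 1), (-1 : ℤ) ^ (i + j) • K i j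
  let high : ℕ → G := fun j =>
    ∑ x ∈ Finset.range (N - j), (-1 : ℤ) ^ (j + 1 + x + j) • K (j + 1 + x) j
  let front : ℕ → G := fun j => ∑ i ∈ Finset.range j, (-1 : ℤ) ^ (i + j) • F i j
  -- By `h_eq` the rows j and j + 1 of column j contribute `diag j - diag (j + 1)`, which
  -- telescopes. The value beyond N is chosen so that the last column fits the pattern.
  let diag : ℕ → G := fun j => if j ≤ N then F j j else F (N + 1) N
  have hK : ∀ j ∈ Finset.range N,
      ∑ i ∈ Finset.range (N + 1), (-1 : ℤ) ^ (i + j) • K i j = low j + high j := by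
    intro j hj
    rw [Finset.mem_range] at hj
    rw [show N + 1 = (j + 1) + (N - j) by omega, Finset.sum_range_add]
  have hF : ∀ j ∈ Finset.range (N + 1),
      ∑ i ∈ Finset.range (N + 2), (-1 : ℤ) ^ (i + j) • F i j
        = front j + (diag j - diag (j + 1)) - high j := by
    intro j hj
    have hj' : j ≤ N := Nat.lt_succ_iff.mp (Finset.mem_range.mp hj)
    have hd : diag (j + 1) = F (j + 1) j := by
      rcases hj'.lt_or_eq with h | rfl
      · simp only [diag, if_pos (Nat.succ_le_of_lt h), h_eq j h]
      · simp [diag]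
    have hh : ∑ x ∈ Finset.range (N - j), (-1 : ℤ) ^ (j + (2 + x) + j) • F (j + (2 + x)) j
        = - high j := by
      rw [← Finset.sum_neg_distrib]
      refine Finset.sum_congr rfl fun x hx => ?_
      rw [Finset.mem_range] at hx
      rw [show j + (2 + x) = (j + 1 + x) + 1 by omega, h_gt _ _ (by omega) (by omega), ← neg_smul]
      congr 1
      ring
    have hs : (-1 : ℤ) ^ (j + j) = 1 := Even.neg_one_pow ⟨j, rfl⟩
    rw [show N + 2 = j + (2 + (N - j)) by omega, Finset.sum_range_add, Finset.sum_range_add, hh,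
      hd, Finset.sum_range_succ, Finset.sum_range_one]
    simp only [diag, if_pos hj', add_zero, hs, one_smul,
      show j + 1 + j = (j + j) + 1 by omega, pow_succ, one_mul, neg_smul]
    simp only [front]
    abel
  -- Column 0 has no front part, and by `h_lt` the front of column j + 1 is `low j` with the sign
  -- reversed by the shift of the column.
  have hfront : ∑ j ∈ Finset.range (N + 1), front j = - ∑ j ∈ Finset.range N, low j := by
    rw [Finset.sum_range_succ', ← Finset.sum_neg_distrib]
    simp only [front, Finset.range_zero, Finset.sum_empty, add_zero]
    refine Finset.sum_congr rfl fun j hj => ?_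
    rw [Finset.mem_range] at hj
    simp only [low]
    rw [← Finset.sum_neg_distrib]
    refine Finset.sum_congr rfl fun i hi => ?_
    rw [Finset.mem_range] at hi
    rw [h_lt _ _ (by omega) hj, ← neg_smul]
    congr 1
    ring
  have hhigh : ∑ j ∈ Finset.range (N + 1), high j = ∑ j ∈ Finset.range N, high j := by
    rw [Finset.sum_range_succ]
    simp [high]
  rw [Finset.sum_congr rfl hK, Finset.sum_congr rfl hF, Finset.sum_sub_distrib,
    Finset.sum_add_distrib, Finset.sum_add_distrib, hfront, hhigh, Finset.sum_range_sub']
  simp only [diag, Nat.zero_le, if_true, Nat.not_succ_le_self, if_false]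
  abel

/-! ## Functoriality of the Hochschild complex -/

namespace Hochschild

variable (k : Type u) [CommRing k]

section functoriality

variable (C : Type u) [Ring C] [Algebra k C]
  (X : Type u) [AddCommGroup X] [Module k X] [Module C X] [Module Cᵐᵒᵖ X]
  (D : Type u) [Ring D] [Algebra k D]
  (Y : Type u) [AddCommGroup Y] [Module k Y] [Module D Y] [Module Dᵐᵒᵖ Y]

/-- A morphism from the algebra `C` with the bimodule `X` to the algebra `D` with the bimodule `Y`:
a multiplicative, not necessarily unital map of algebras and a compatible map of modules. -/
structure PairHom where
  alg : C →ₙₐ[k] D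
  mod : X →ₗ[k] Y
  map_lsmul : ∀ c x, mod (c • x) = alg c • mod x
  map_rsmul : ∀ (c : C) x, mod (op c • x) = op (alg c) • mod x

variable {k C X D Y}

/-- The map of Hochschild chains induced by a morphism of pairs. -/
def PairHom.chainMap (F : PairHom k C X D Y) (n : ℕ) : Chain k C X n →ₗ[k] Chain k D Y n :=
  TensorProduct.map F.mod (PiTensorProduct.map fun _ => (F.alg : C →ₗ[k] D))

@[simp] theorem PairHom.chainMap_tmul_tprod (F : PairHom k C X D Y) (n : ℕ) (x : X)
    (m : Fin n → C) :
    F.chainMap n (x ⊗ₜ PiTensorProduct.tprod k m)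
      = F.mod x ⊗ₜ PiTensorProduct.tprod k (fun q => F.alg (m q)) := by
  simp [chainMap]

variable [SMulCommClass C Cᵐᵒᵖ X] [IsScalarTower k C X] [IsScalarTower k Cᵐᵒᵖ X]
  [SMulCommClass D Dᵐᵒᵖ Y] [IsScalarTower k D Y] [IsScalarTower k Dᵐᵒᵖ Y]

/-- Faces are built from products and the two actions alone. Units never occur, which is why
non-unital algebra maps, such as the inclusion of a corner, are allowed. -/
theorem PairHom.face_chainMap (F : PairHom k C X D Y) (n : ℕ) (i : Fin (n + 2)) :
    (face k D Y n i).comp (F.chainMap (n + 1)) = (F.chainMap n).comp (face k C X n i) := by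
  apply chain_hom_ext
  intro x m
  simp only [LinearMap.comp_apply, chainMap_tmul_tprod, face_tmul_tprod]
  congr 1
  · simp only [faceX]
    split_ifs
    · rw [F.map_rsmul]
    · rw [F.map_lsmul]
    · rfl
  · congr 1
    ext q
    simp only [faceC]
    split_ifs <;> simp

theorem PairHom.boundary_chainMap (F : PairHom k C X D Y) (n : ℕ) :
    (boundary k D Y n).comp (F.chainMap (n + 1)) = (F.chainMap n).comp (boundary k C X n) := by
  refine LinearMap.ext fun x => ?_
  simp only [boundary, LinearMap.comp_apply, LinearMap.sum_apply, LinearMap.smul_apply, map_sum,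
    map_zsmul]
  exact Finset.sum_congr rfl fun i _ =>
    congrArg _ (LinearMap.congr_fun (F.face_chainMap n i) x)

variable (k C X) in
theorem complex_d (n : ℕ) :
    (complex k C X).d (n + 1) n = ModuleCat.ofHom (boundary k C X n) := by
  simp [complex]

/-- The map of Hochschild complexes induced by a morphism of pairs. -/
def PairHom.complexMap (F : PairHom k C X D Y) : complex k C X ⟶ complex k D Y :=
  ChainComplex.ofHom (fun n => ModuleCat.ofHom (F.chainMap n)) (fun n => by
    rw [complex_d, complex_d]
    exact congrArg ModuleCat.ofHom (F.boundary_chainMap n))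

end functoriality

/-! ## Compression by an idempotent -/

section compression

variable {k}
variable {C : Type u} [Ring C] [Algebra k C]
  {X : Type u} [AddCommGroup X] [Module k X] [Module C X] [Module Cᵐᵒᵖ X]
  [SMulCommClass C Cᵐᵒᵖ X] [IsScalarTower k C X] [IsScalarTower k Cᵐᵒᵖ X]

/-- The tuple `c₀, …, cⱼ₋₁, e, cⱼ e, …, cₙ₋₁ e`. -/
def compressTuple (e : C) {n : ℕ} (j : Fin (n + 1)) (m : Fin n → C) : Fin (n + 1) → C :=
  j.insertNth e (fun q => if q.val < j.val then m q else m q * e)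

/-- The simplicial homotopy `x ⊗ c₀ ⊗ ⋯ ⊗ cₙ₋₁ ↦ x ⊗ c₀ ⊗ ⋯ ⊗ cⱼ₋₁ ⊗ e ⊗ cⱼ e ⊗ ⋯ ⊗ cₙ₋₁ e`. -/
def compressOp (k : Type u) [CommRing k] {C : Type u} [Ring C] [Algebra k C]
    (X : Type u) [AddCommGroup X] [Module k X] (e : C) {n : ℕ} (j : Fin (n + 1)) :
    Chain k C X n →ₗ[k] Chain k C X (n + 1) :=
  ((PiTensorProduct.lift
    ((PiTensorProduct.tprod k (s := fun _ : Fin (n + 1) => C)).curryMid j e)).comp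
    (PiTensorProduct.map fun q : Fin n =>
      if q.val < j.val then LinearMap.id else LinearMap.mulRight k e)).lTensor X

theorem compressOp_tmul_tprod (e : C) {n : ℕ} (j : Fin (n + 1)) (x : X) (m : Fin n → C) :
    compressOp k X e j (x ⊗ₜ PiTensorProduct.tprod k m)
      = x ⊗ₜ PiTensorProduct.tprod k (compressTuple e j m) := by
  simp only [compressOp, LinearMap.lTensor_tmul, LinearMap.comp_apply, PiTensorProduct.map_tprod,
    PiTensorProduct.lift.tprod, MultilinearMap.curryMid_apply_apply, compressTuple]
  congr 3
  ext q
  split_ifs <;> simp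

/-- With the tuple extended to a function on ℕ, insertion becomes a shift of a natural number index,
and the face identities below reduce to case distinctions in linear arithmetic. -/
theorem compressTuple_apply (e : C) {n : ℕ} (j : Fin (n + 1)) (m : Fin n → C) (f : ℕ → C)
    (hf : ∀ q, m q = f q.val) (q : Fin (n + 1)) :
    compressTuple e j m q = if q.val < j.val then f q.val else if q.val = j.val then e
      else f (q.val - 1) * e := by
  induction q using Fin.succAboveCases j with
  | x => simp [compressTuple]
  | p i =>
    rw [compressTuple, Fin.insertNth_apply_succAbove]
    simp only [hf]
    by_cases h : i.val < j.val
    · rw [Fin.succAbove_of_castSucc_lt _ _ h]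
      simp [h]
    · rw [Fin.succAbove_of_le_castSucc _ _ (not_lt.mp h)]
      have h1 : ¬ (i.val + 1 < j.val) := by omega
      have h2 : ¬ (i.val + 1 = j.val) := by omega
      simp [h, h1, h2]

theorem exists_eq_comp_val {n : ℕ} (m : Fin n → C) : ∃ f : ℕ → C, ∀ q : Fin n, m q = f q.val :=
  ⟨fun t => if h : t < n then m ⟨t, h⟩ else 0, fun q => by simp only [q.isLt, dif_pos, Fin.eta]⟩

/-- Such a face acts in front of the inserted e, on factors not multiplied by e, so nothing has to
be assumed about e. -/
theorem face_compressOp_of_le (e : C) (n : ℕ) (i : Fin (n + 2)) (j : Fin (n + 1))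
    (hij : i.val ≤ j.val) :
    (face k C X (n + 1) i.castSucc).comp (compressOp k X e j.succ)
      = (compressOp k X e j).comp (face k C X n i) := by
  apply chain_hom_ext
  intro x m
  simp only [LinearMap.comp_apply, face_tmul_tprod, compressOp_tmul_tprod]
  obtain ⟨f, hf⟩ := exists_eq_comp_val m
  have hi := i.isLt
  have hj := j.isLt
  congr 1
  · simp only [faceX, compressTuple_apply e _ m f hf, hf, Fin.val_succ, Fin.val_castSucc,
      Fin.val_last, Fin.val_zero]
    grind
  · congr 1
    ext q
    have hq := q.isLt
    rw [compressTuple_apply e j (faceC C i m) (fun t => if t + 1 < i.val then f t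
      else if t + 1 = i.val then f t * f (t + 1) else f (t + 1))
      (fun q => by simp [faceC, hf])]
    simp only [faceC, compressTuple_apply e _ m f hf, Fin.val_succ, Fin.val_castSucc]
    generalize i.val = i at *
    generalize j.val = j at *
    generalize q.val = q at *
    clear hf
    grind

variable {e : C}

/-- Such a face acts behind the inserted e. Inner faces agree because (c e)(d e) = c d e, and the
last face because (c e) x = c x. -/
theorem face_compressOp_of_gt (he : ∀ c, e * (c * e) = c * e) (hX : ∀ x : X, e • x = x)
    (n : ℕ) (i : Fin (n + 2)) (j : Fin (n + 1)) (hij : j.val < i.val) :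
    (face k C X (n + 1) i.succ).comp (compressOp k X e j.castSucc)
      = (compressOp k X e j).comp (face k C X n i) := by
  apply chain_hom_ext
  intro x m
  simp only [LinearMap.comp_apply, face_tmul_tprod, compressOp_tmul_tprod]
  obtain ⟨f, hf⟩ := exists_eq_comp_val m
  have hi := i.isLt
  have hj := j.isLt
  congr 1
  · have h0 : ∀ c : C, (c * e) • x = c • x := fun c => by rw [mul_smul, hX]
    simp only [faceX, compressTuple_apply e _ m f hf, hf, Fin.val_succ, Fin.val_castSucc,
      Fin.val_last, Fin.val_zero]
    grind
  · congr 1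
    ext q
    have hq := q.isLt
    rw [compressTuple_apply e j (faceC C i m) (fun t => if t + 1 < i.val then f t
      else if t + 1 = i.val then f t * f (t + 1) else f (t + 1))
      (fun q => by simp [faceC, hf])]
    simp only [faceC, compressTuple_apply e _ m f hf, Fin.val_succ, Fin.val_castSucc]
    have h0 : ∀ c d : C, c * e * (d * e) = c * d * e := fun c d => by
      rw [mul_assoc, he, mul_assoc]
    generalize i.val = i at *
    generalize j.val = j at *
    generalize q.val = q at *
    clear hf
    grind

/-- Here the face merges the inserted e with the factor cⱼ: one side gives cⱼ e, the other e (cⱼ e),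
and these coincide by `he`. -/
theorem face_compressOp_eq (he : ∀ c, e * (c * e) = c * e) (n : ℕ) (j : Fin (n + 1)) :
    (face k C X (n + 1) j.succ.castSucc).comp (compressOp k X e j.succ)
      = (face k C X (n + 1) j.succ.castSucc).comp (compressOp k X e j.castSucc) := by
  apply chain_hom_ext
  intro x m
  simp only [LinearMap.comp_apply, face_tmul_tprod, compressOp_tmul_tprod]
  obtain ⟨f, hf⟩ := exists_eq_comp_val m
  have hj := j.isLt
  congr 1
  · simp only [faceX, compressTuple_apply e _ m f hf, Fin.val_succ, Fin.val_castSucc,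
      Fin.val_last, Fin.val_zero]
    grind
  · congr 1
    ext q
    have hq := q.isLt
    simp only [faceC, compressTuple_apply e _ m f hf, Fin.val_succ, Fin.val_castSucc]
    generalize j.val = j at *
    generalize q.val = q at *
    clear hf
    grind

/-- Of all faces of the homotopy only two survive the cancellation. This one is the compression map;
the other, in `face_last_compressOp`, is the identity. -/
theorem face_zero_compressOp (n : ℕ) (x : X) (m : Fin n → C) :
    face k C X n 0 (compressOp k X e 0 (x ⊗ₜ PiTensorProduct.tprod k m))
      = (op e • x) ⊗ₜ PiTensorProduct.tprod k (fun q => m q * e) := by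
  simp only [face_tmul_tprod, compressOp_tmul_tprod]
  obtain ⟨f, hf⟩ := exists_eq_comp_val m
  have h : faceC C 0 (compressTuple e 0 m) = fun q => m q * e := by
    ext q
    simp [faceC, compressTuple_apply e _ m f hf, hf]
  simp [faceX, compressTuple_apply e _ m f hf, h]

/-- The inserted e stands last, and the last face carries it around to the left of x, where it acts
trivially. -/
theorem face_last_compressOp (hX : ∀ x : X, e • x = x) (n : ℕ) :
    (face k C X n (Fin.last (n + 1))).comp (compressOp k X e (Fin.last n)) = LinearMap.id := by
  apply chain_hom_ext
  intro x m
  simp only [LinearMap.comp_apply, face_tmul_tprod, compressOp_tmul_tprod, LinearMap.id_apply]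
  obtain ⟨f, hf⟩ := exists_eq_comp_val m
  congr 1
  · simp [faceX, compressTuple_apply e _ m f hf, hX]
  · congr 1
    ext q
    simp [faceC, compressTuple_apply e _ m f hf, hf]

variable (k X e) in
/-- The alternating sum of the operators `compressOp`. -/
def compressHomotopy (n : ℕ) : Chain k C X n →ₗ[k] Chain k C X (n + 1) :=
  ∑ j : Fin (n + 1), (-1 : ℤ) ^ (j : ℕ) • compressOp k X e j

/-- Indexing by natural numbers gives the double sum the shape required by
`alternating_sum_simplicial_homotopy`. All indices are in range, so `Fin.ofNat` never wraps around.
-/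
theorem boundary_compressHomotopy_apply (n : ℕ) (t : Chain k C X n) :
    boundary k C X n (compressHomotopy k X e n t)
      = ∑ j ∈ Finset.range (n + 1), ∑ i ∈ Finset.range (n + 2), (-1 : ℤ) ^ (i + j) •
        face k C X n (Fin.ofNat _ i) (compressOp k X e (Fin.ofNat _ j) t) := by
  simp only [Finset.sum_range, Fin.ofNat_eq_cast, Fin.cast_val_eq_self, boundary,
    compressHomotopy, LinearMap.sum_apply, LinearMap.smul_apply, map_sum, map_zsmul, Finset.smul_sum,
    smul_smul, pow_add]
  simp only [mul_comm]

theorem compressHomotopy_boundary_apply (n : ℕ) (t : Chain k C X (n + 1)) :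
    compressHomotopy k X e n (boundary k C X n t)
      = ∑ j ∈ Finset.range (n + 1), ∑ i ∈ Finset.range (n + 2), (-1 : ℤ) ^ (i + j) •
        compressOp k X e (Fin.ofNat _ j) (face k C X n (Fin.ofNat _ i) t) := by
  simp only [Finset.sum_range, Fin.ofNat_eq_cast, Fin.cast_val_eq_self, boundary,
    compressHomotopy, LinearMap.sum_apply, LinearMap.smul_apply, map_sum, map_zsmul, Finset.smul_sum,
    smul_smul, pow_add]
  rw [Finset.sum_comm]

theorem compressHomotopy_zero (hX : ∀ x : X, e • x = x) (t : Chain k C X 0) :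
    boundary k C X 0 (compressHomotopy k X e 0 t) = face k C X 0 0 (compressOp k X e 0 t) - t := by
  -- In degree zero there is no boundary to precede the homotopy: the sum over K is empty, and 0 is
  -- a dummy value for it.
  have h := alternating_sum_simplicial_homotopy 0
    (fun i j => face k C X 0 (Fin.ofNat _ i) (compressOp k X e (Fin.ofNat _ j) t)) (fun _ _ => 0)
    (fun _ _ _ h => absurd h (Nat.not_lt_zero _)) (fun _ _ h h' => by omega)
    (fun _ h => absurd h (Nat.not_lt_zero _))
  rw [boundary_compressHomotopy_apply]
  rw [Finset.range_zero, Finset.sum_empty, zero_add] at h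
  rw [h]
  exact congrArg _ (LinearMap.congr_fun (face_last_compressOp hX 0) t)

theorem compressHomotopy_succ (he : ∀ c, e * (c * e) = c * e) (hX : ∀ x : X, e • x = x) (n : ℕ)
    (t : Chain k C X (n + 1)) :
    compressHomotopy k X e n (boundary k C X n t)
      + boundary k C X (n + 1) (compressHomotopy k X e (n + 1) t)
      = face k C X (n + 1) 0 (compressOp k X e 0 t) - t := by
  have h := alternating_sum_simplicial_homotopy (n + 1)
    (fun i j => face k C X (n + 1) (Fin.ofNat _ i) (compressOp k X e (Fin.ofNat _ j) t))
    (fun i j => compressOp k X e (Fin.ofNat _ j) (face k C X n (Fin.ofNat _ i) t)) ?_ ?_ ?_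
  · rw [boundary_compressHomotopy_apply, compressHomotopy_boundary_apply, h]
    refine congrArg₂ _ rfl ?_
    have h1 : (Fin.ofNat (n + 1 + 2) (n + 1 + 1)) = Fin.last (n + 1 + 1) := by ext; simp
    have h2 : (Fin.ofNat (n + 1 + 1) (n + 1)) = Fin.last (n + 1) := by ext; simp
    rw [h1, h2]
    exact LinearMap.congr_fun (face_last_compressOp hX (n + 1)) t
  · intro i j hij hj
    have h := LinearMap.congr_fun
      (face_compressOp_of_le (k := k) (X := X) e n ⟨i, by omega⟩ ⟨j, hj⟩ hij) t
    have e1 : Fin.ofNat (n + 1 + 2) i = (⟨i, by omega⟩ : Fin (n + 2)).castSucc := by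
      ext; simp; omega
    have e2 : Fin.ofNat (n + 1 + 1) (j + 1) = (⟨j, hj⟩ : Fin (n + 1)).succ := by
      ext; simp; omega
    have e3 : Fin.ofNat (n + 1) j = ⟨j, hj⟩ := by ext; simp; omega
    have e4 : Fin.ofNat (n + 2) i = ⟨i, by omega⟩ := by ext; simp; omega
    rw [e1, e2, e3, e4]
    exact h
  · intro i j hij hi
    have h := LinearMap.congr_fun
      (face_compressOp_of_gt (k := k) he hX n ⟨i, by omega⟩ ⟨j, by omega⟩ hij) t
    have e1 : Fin.ofNat (n + 1 + 2) (i + 1) = (⟨i, by omega⟩ : Fin (n + 2)).succ := by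
      ext; simp; omega
    have e2 : Fin.ofNat (n + 1 + 1) j = (⟨j, by omega⟩ : Fin (n + 1)).castSucc := by
      ext; simp; omega
    have e3 : Fin.ofNat (n + 1) j = ⟨j, by omega⟩ := by ext; simp; omega
    have e4 : Fin.ofNat (n + 2) i = ⟨i, by omega⟩ := by ext; simp; omega
    rw [e1, e2, e3, e4]
    exact h
  · intro j hj
    have h := LinearMap.congr_fun
      (face_compressOp_eq (k := k) (X := X) he n ⟨j, hj⟩) t
    have e1 : Fin.ofNat (n + 1 + 2) (j + 1) = (⟨j, hj⟩ : Fin (n + 1)).succ.castSucc := by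
      ext; simp; omega
    have e2 : Fin.ofNat (n + 1 + 1) j = (⟨j, hj⟩ : Fin (n + 1)).castSucc := by
      ext; simp; omega
    have e3 : Fin.ofNat (n + 1 + 1) (j + 1) = (⟨j, hj⟩ : Fin (n + 1)).succ := by
      ext; simp; omega
    rw [e1, e2, e3]
    exact h

/-- If `e` satisfies `e C e = C e` and acts as the identity on the left of `X`, then
`x ⊗ c₁ ⊗ ⋯ ⊗ cₙ ↦ x e ⊗ c₁ e ⊗ ⋯ ⊗ cₙ e` induces the identity on Hochschild homology. -/
theorem homologyMap_compress (he : ∀ c, e * (c * e) = c * e) (hX : ∀ x : X, e • x = x)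
    (F : PairHom k C X C X) (hF : ∀ c, F.alg c = c * e) (hF' : ∀ x, F.mod x = op e • x) (n : ℕ) :
    HomologicalComplex.homologyMap F.complexMap n = 𝟙 _ := by
  -- The map to be contracted is exactly the surviving term F 0 0 of the alternating sum.
  have hface : ∀ n t, F.chainMap n t = face k C X n 0 (compressOp k X e 0 t) := fun n =>
    LinearMap.congr_fun (g := (face k C X n 0).comp (compressOp k X e 0))
      (chain_hom_ext _ _ _ fun x m => by
        simp only [LinearMap.comp_apply, face_zero_compressOp, PairHom.chainMap_tmul_tprod, hF,
          hF'])
  rw [← HomologicalComplex.homologyMap_id]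
  refine ChainComplex.homologyMap_eq_of_homotopy _ _
    (fun n => ModuleCat.ofHom (compressHomotopy k X e n)) ?_ (fun n => ?_) n
  · rw [complex_d]
    refine ModuleCat.hom_ext (LinearMap.ext fun t => ?_)
    exact (hface 0 t).trans (eq_add_of_sub_eq (compressHomotopy_zero hX t).symm)
  · rw [complex_d, complex_d]
    refine ModuleCat.hom_ext (LinearMap.ext fun t => ?_)
    exact (hface _ t).trans (eq_add_of_sub_eq (compressHomotopy_succ he hX n t).symm)

end compression

end Hochschild

/-! ## Independence of the relative `Tor` of the resolution -/

/-- The recursion carries each term together with the existence of a successor. It serves to build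
chain maps and homotopies degree by degree, where the next component exists only because the
previous one satisfies its relation. -/
theorem exists_dependent_seq {α : ℕ → Type*} (r : ∀ n, α n → α (n + 1) → Prop) (a : α 0)
    (h_zero : ∃ b, r 0 a b) (h_succ : ∀ n a b, r n a b → ∃ c, r (n + 1) b c) :
    ∃ f : ∀ n, α n, f 0 = a ∧ ∀ n, r n (f n) (f (n + 1)) := by
  choose next h_next using fun n (x : {x : α n // ∃ b, r n x b}) => x.2
  let F : ∀ n, {x : α n // ∃ b, r n x b} := fun n =>
    Nat.rec ⟨a, h_zero⟩ (fun n x => ⟨next n x, h_succ n _ _ (h_next n x)⟩) n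
  exact ⟨fun n => (F n).1, rfl, fun n => h_next n (F n)⟩

section comparison

variable {k : Type u} [CommRing k] {R : Type u} [Ring R] [Algebra k R]

/-- On ker d₀ the map s is a k-linear section of d₁ : U → ker d₀, so this surjection belongs to the
relative class and P lifts through it. -/
theorem IsRelProjective.exists_lift_of_exact {P U V W : Type u} [AddCommGroup P] [Module R P]
    [AddCommGroup U] [AddCommGroup V] [AddCommGroup W] [Module k U] [Module k V]
    [Module R U] [Module R V] [Module R W] [IsScalarTower k R U] [IsScalarTower k R V]
    (hP : IsRelProjective k R P) {d₁ : U →ₗ[R] V} {d₀ : V →ₗ[R] W} (hd : d₀.comp d₁ = 0)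
    (s : V →ₗ[k] U) (hs : ∀ v, d₀ v = 0 → d₁ (s v) = v) (g : P →ₗ[R] V) (hg : d₀.comp g = 0) :
    ∃ h : P →ₗ[R] U, d₁.comp h = g := by
  obtain ⟨h, hh⟩ := hP U (LinearMap.ker d₀)
    (d₁.codRestrict _ fun u => LinearMap.congr_fun hd u)
    (s.comp ((LinearMap.ker d₀).subtype.restrictScalars k))
    (fun v => Subtype.ext (hs v.1 v.2))
    (g.codRestrict _ fun p => LinearMap.congr_fun hg p)
  exact ⟨h, LinearMap.ext fun p => congrArg Subtype.val (LinearMap.congr_fun hh p)⟩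

namespace RelProjResolution

variable {Y : Type u} [AddCommGroup Y] [Module k Y] [Module R Y] [IsScalarTower k R Y]
  {Z : Type u} [AddCommGroup Z] [Module R Z]

theorem exists_lift_augmentation (Q : RelProjResolution k R Y) (hZ : IsRelProjective k R Z)
    (g : Z →ₗ[R] Y) : ∃ h : Z →ₗ[R] Q.P 0, Q.ε.comp h = g := by
  obtain ⟨s', s, h', h0, h1⟩ := Q.contractible
  exact hZ _ _ Q.ε s' h' g

/-- On the kernel of the outgoing map the contraction identity loses one term and says that s is a
section of the incoming differential. The same applies in higher degrees. -/
theorem exists_lift_zero (Q : RelProjResolution k R Y) (hZ : IsRelProjective k R Z)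
    (g : Z →ₗ[R] Q.P 0) (hg : Q.ε.comp g = 0) : ∃ h : Z →ₗ[R] Q.P 1, (Q.d 0).comp h = g := by
  obtain ⟨s', s, h', h0, h1⟩ := Q.contractible
  refine hZ.exists_lift_of_exact Q.ε_comp_d (s 0) (fun v hv => ?_) g hg
  simpa [hv] using h0 v

theorem exists_lift_succ (Q : RelProjResolution k R Y) (hZ : IsRelProjective k R Z) (n : ℕ)
    (g : Z →ₗ[R] Q.P (n + 1)) (hg : (Q.d n).comp g = 0) :
    ∃ h : Z →ₗ[R] Q.P (n + 2), (Q.d (n + 1)).comp h = g := by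
  obtain ⟨s', s, h', h0, h1⟩ := Q.contractible
  refine hZ.exists_lift_of_exact (Q.d_comp_d n) (s (n + 1)) (fun v hv => ?_) g hg
  simpa [hv] using h1 n v

/-- A morphism of resolutions of `Y` over the identity of `Y`. -/
structure Hom (P Q : RelProjResolution k R Y) where
  f : ∀ n, P.P n →ₗ[R] Q.P n
  ε_comp : Q.ε.comp (f 0) = P.ε
  comm : ∀ n, (Q.d n).comp (f (n + 1)) = (f n).comp (P.d n)

theorem nonempty_hom (P Q : RelProjResolution k R Y) : Nonempty (Hom P Q) := by
  obtain ⟨f₀, hf₀⟩ := Q.exists_lift_augmentation (P.relProjective 0) P.ε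
  obtain ⟨f, h_zero, hf⟩ := exists_dependent_seq (α := fun n => P.P n →ₗ[R] Q.P n)
    (fun n a b => (Q.d n).comp b = a.comp (P.d n)) f₀
    (Q.exists_lift_zero (P.relProjective 1) _ (by
      rw [← LinearMap.comp_assoc, hf₀, P.ε_comp_d]))
    (fun n a b hab => Q.exists_lift_succ (P.relProjective (n + 2)) n _ (by
      rw [← LinearMap.comp_assoc, hab, LinearMap.comp_assoc, P.d_comp_d, LinearMap.comp_zero]))
  exact ⟨⟨f, by rw [h_zero, hf₀], hf⟩⟩

/-- Any two morphisms of resolutions are homotopic. -/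
theorem Hom.exists_homotopy {P Q : RelProjResolution k R Y} (F G : Hom P Q) :
    ∃ h : ∀ n, P.P n →ₗ[R] Q.P (n + 1), F.f 0 = (Q.d 0).comp (h 0) + G.f 0 ∧
      ∀ n, F.f (n + 1) = (h n).comp (P.d n) + (Q.d (n + 1)).comp (h (n + 1)) + G.f (n + 1) := by
  obtain ⟨h₀, hh₀⟩ := Q.exists_lift_zero (P.relProjective 0) (F.f 0 - G.f 0) (by
    rw [LinearMap.comp_sub, F.ε_comp, G.ε_comp, sub_self])
  -- The next component has to lift F - G - h d, which takes values in cycles by the relation for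
  -- the previous component.
  obtain ⟨h, h_zero, hh⟩ := exists_dependent_seq (α := fun n => P.P n →ₗ[R] Q.P (n + 1))
    (fun n a b => (Q.d (n + 1)).comp b = F.f (n + 1) - G.f (n + 1) - a.comp (P.d n)) h₀
    (Q.exists_lift_succ (P.relProjective 1) 0 _ (by
      rw [LinearMap.comp_sub, LinearMap.comp_sub, F.comm, G.comm, ← LinearMap.comp_assoc, hh₀,
        LinearMap.sub_comp, sub_self]))
    (fun n a b hab => Q.exists_lift_succ (P.relProjective (n + 2)) (n + 1) _ (by
      rw [LinearMap.comp_sub, LinearMap.comp_sub, F.comm, G.comm, ← LinearMap.comp_assoc, hab,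
        LinearMap.sub_comp, LinearMap.sub_comp, LinearMap.comp_assoc, P.d_comp_d,
        LinearMap.comp_zero, sub_zero, sub_self]))
  refine ⟨h, by rw [h_zero, hh₀, sub_add_cancel], fun n => ?_⟩
  rw [hh]
  abel

/-- The identity morphism of a resolution. -/
def Hom.id (P : RelProjResolution k R Y) : Hom P P where
  f _ := LinearMap.id
  ε_comp := rfl
  comm _ := rfl

/-- The composition of morphisms of resolutions. -/
def Hom.comp {P Q S : RelProjResolution k R Y} (G : Hom Q S) (F : Hom P Q) : Hom P S where
  f n := (G.f n).comp (F.f n)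
  ε_comp := by rw [← LinearMap.comp_assoc, G.ε_comp, F.ε_comp]
  comm n := by rw [← LinearMap.comp_assoc, G.comm, LinearMap.comp_assoc, F.comm,
    LinearMap.comp_assoc]

end RelProjResolution

section balanced

variable (N : Type u) [AddCommGroup N] [Module k N] [Module Rᵐᵒᵖ N] [IsScalarTower k Rᵐᵒᵖ N]
  {P Q S : Type u} [AddCommGroup P] [Module k P] [Module R P] [IsScalarTower k R P]
  [AddCommGroup Q] [Module k Q] [Module R Q] [IsScalarTower k R Q]
  [AddCommGroup S] [Module k S] [Module R S] [IsScalarTower k R S]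

theorem BalancedTensor.hom_ext {Z : Type u} [AddCommGroup Z] [Module k Z]
    {f g : BalancedTensor k R N P →ₗ[k] Z}
    (h : ∀ x p, f (Submodule.Quotient.mk (x ⊗ₜ p)) = g (Submodule.Quotient.mk (x ⊗ₜ p))) :
    f = g := by
  apply Submodule.linearMap_qext
  apply TensorProduct.ext'
  exact h

@[simp] theorem BalancedTensor.map_mk_tmul (f : P →ₗ[R] Q) (x : N) (p : P) :
    BalancedTensor.map k R N f (Submodule.Quotient.mk (x ⊗ₜ p))
      = Submodule.Quotient.mk (x ⊗ₜ f p) := rfl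

theorem BalancedTensor.map_comp (g : Q →ₗ[R] S) (f : P →ₗ[R] Q) :
    BalancedTensor.map k R N (g.comp f)
      = (BalancedTensor.map k R N g).comp (BalancedTensor.map k R N f) :=
  BalancedTensor.hom_ext N fun _ _ => rfl

theorem BalancedTensor.map_id :
    BalancedTensor.map k R N (LinearMap.id : P →ₗ[R] P) = LinearMap.id :=
  BalancedTensor.hom_ext N fun _ _ => rfl

theorem BalancedTensor.map_add (f g : P →ₗ[R] Q) :
    BalancedTensor.map k R N (f + g)
      = BalancedTensor.map k R N f + BalancedTensor.map k R N g :=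
  BalancedTensor.hom_ext N fun x p => by
    simp [TensorProduct.tmul_add]

end balanced

namespace RelProjResolution

variable (N : Type u) [AddCommGroup N] [Module k N] [Module Rᵐᵒᵖ N] [IsScalarTower k Rᵐᵒᵖ N]
  {Y : Type u} [AddCommGroup Y] [Module k Y] [Module R Y] [IsScalarTower k R Y]

theorem torComplex_d (P : RelProjResolution k R Y) (n : ℕ) :
    (P.torComplex N).d (n + 1) n = ModuleCat.ofHom (BalancedTensor.map k R N (P.d n)) := by
  simp [torComplex]

/-- The map of complexes `N ⊗_R P_* ⟶ N ⊗_R Q_*` induced by a morphism of resolutions. -/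
def Hom.torComplexMap {P Q : RelProjResolution k R Y} (F : Hom P Q) :
    P.torComplex N ⟶ Q.torComplex N :=
  ChainComplex.ofHom (fun n => ModuleCat.ofHom (BalancedTensor.map k R N (F.f n))) (fun n => by
    rw [torComplex_d, torComplex_d]
    refine congrArg ModuleCat.ofHom ((BalancedTensor.map_comp N _ _).symm.trans ?_)
    rw [F.comm, BalancedTensor.map_comp]
    rfl)

theorem Hom.torComplexMap_id (P : RelProjResolution k R Y) :
    (Hom.id P).torComplexMap N = 𝟙 _ := by
  ext n : 1
  exact congrArg ModuleCat.ofHom (BalancedTensor.map_id N)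

theorem Hom.torComplexMap_comp {P Q S : RelProjResolution k R Y} (F : Hom P Q) (G : Hom Q S) :
    (G.comp F).torComplexMap N = F.torComplexMap N ≫ G.torComplexMap N := by
  ext n : 1
  exact congrArg ModuleCat.ofHom (BalancedTensor.map_comp N _ _)

/-- The homotopy between two morphisms is R-linear, hence it survives N ⊗_R -. -/
theorem Hom.homologyMap_torComplexMap_eq {P Q : RelProjResolution k R Y} (F G : Hom P Q) (n : ℕ) :
    HomologicalComplex.homologyMap (F.torComplexMap N) n
      = HomologicalComplex.homologyMap (G.torComplexMap N) n := by
  obtain ⟨h, h0, h1⟩ := F.exists_homotopy G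
  refine ChainComplex.homologyMap_eq_of_homotopy _ _
    (fun n => ModuleCat.ofHom (BalancedTensor.map k R N (h n))) ?_ (fun n => ?_) n
  · rw [torComplex_d]
    refine (congrArg (fun f => ModuleCat.ofHom (BalancedTensor.map k R N f)) h0).trans ?_
    rw [BalancedTensor.map_add, BalancedTensor.map_comp]
    rfl
  · rw [torComplex_d, torComplex_d]
    refine (congrArg (fun f => ModuleCat.ofHom (BalancedTensor.map k R N f)) (h1 n)).trans ?_
    rw [BalancedTensor.map_add, BalancedTensor.map_add, BalancedTensor.map_comp,
      BalancedTensor.map_comp]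
    rfl

/-- The relative `Tor` does not depend on the resolution. -/
def torIso (P Q : RelProjResolution k R Y) (n : ℕ) : P.tor N n ≅ Q.tor N n where
  hom := HomologicalComplex.homologyMap ((P.nonempty_hom Q).some.torComplexMap N) n
  inv := HomologicalComplex.homologyMap ((Q.nonempty_hom P).some.torComplexMap N) n
  hom_inv_id := by
    -- The round trip is a morphism P → P over the identity of Y, so on homology it agrees with
    -- `Hom.id P`.
    rw [← HomologicalComplex.homologyMap_comp, ← Hom.torComplexMap_comp,
      Hom.homologyMap_torComplexMap_eq N _ (Hom.id P), Hom.torComplexMap_id,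
      HomologicalComplex.homologyMap_id]
  inv_hom_id := by
    rw [← HomologicalComplex.homologyMap_comp, ← Hom.torComplexMap_comp,
      Hom.homologyMap_torComplexMap_eq N _ (Hom.id Q), Hom.torComplexMap_id,
      HomologicalComplex.homologyMap_id]

end RelProjResolution

end comparison

/-! ### Composition of morphisms of pairs, and changes of coefficients -/

namespace Hochschild.PairHom

variable {k : Type u} [CommRing k] {C : Type u} [Ring C] [Algebra k C]
  {X : Type u} [AddCommGroup X] [Module k X] [Module C X] [Module Cᵐᵒᵖ X]
  {D : Type u} [Ring D] [Algebra k D]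
  {Y : Type u} [AddCommGroup Y] [Module k Y] [Module D Y] [Module Dᵐᵒᵖ Y]
  {K : Type u} [Ring K] [Algebra k K]
  {Z : Type u} [AddCommGroup Z] [Module k Z] [Module K Z] [Module Kᵐᵒᵖ Z]

/-- The composition of morphisms of pairs. -/
def comp (G : PairHom k D Y K Z) (F : PairHom k C X D Y) : PairHom k C X K Z where
  alg := G.alg.comp F.alg
  mod := G.mod.comp F.mod
  map_lsmul c x := by simp [F.map_lsmul, G.map_lsmul]
  map_rsmul c x := by simp [F.map_rsmul, G.map_rsmul]

/-- A map of bimodules over the same algebra, as a morphism of pairs. -/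
def ofBimoduleMap {X' : Type u} [AddCommGroup X'] [Module k X'] [Module C X'] [Module Cᵐᵒᵖ X']
    (f : X →ₗ[k] X') (hl : ∀ (c : C) x, f (c • x) = c • f x)
    (hr : ∀ (c : C) x, f (op c • x) = op c • f x) : PairHom k C X C X' where
  alg := NonUnitalAlgHom.id k C
  mod := f
  map_lsmul := hl
  map_rsmul := hr

variable [SMulCommClass C Cᵐᵒᵖ X] [IsScalarTower k C X] [IsScalarTower k Cᵐᵒᵖ X]
  [SMulCommClass D Dᵐᵒᵖ Y] [IsScalarTower k D Y] [IsScalarTower k Dᵐᵒᵖ Y]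
  [SMulCommClass K Kᵐᵒᵖ Z] [IsScalarTower k K Z] [IsScalarTower k Kᵐᵒᵖ Z]

theorem ofBimoduleMap_chainMap {X' : Type u} [AddCommGroup X'] [Module k X'] [Module C X']
    [Module Cᵐᵒᵖ X'] (f : X →ₗ[k] X') (hl : ∀ (c : C) x, f (c • x) = c • f x)
    (hr : ∀ (c : C) x, f (op c • x) = op c • f x) (n : ℕ) :
    (ofBimoduleMap f hl hr).chainMap n = f.rTensor (⨂[k]^n C) :=
  chain_hom_ext _ _ _ fun x m => by
    rw [chainMap_tmul_tprod, LinearMap.rTensor_tmul]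
    rfl

theorem complexMap_comp (G : PairHom k D Y K Z) (F : PairHom k C X D Y) :
    (G.comp F).complexMap = F.complexMap ≫ G.complexMap := by
  ext n : 1
  refine congrArg ModuleCat.ofHom (?_ : _ = (G.chainMap n).comp (F.chainMap n))
  apply chain_hom_ext
  intro x m
  simp only [LinearMap.comp_apply, chainMap_tmul_tprod]
  rfl

theorem complexMap_eq_id (F : PairHom k C X C X) (h : ∀ c, F.alg c = c) (h' : ∀ x, F.mod x = x) :
    F.complexMap = 𝟙 _ := by
  ext n : 1
  refine congrArg ModuleCat.ofHom (?_ : _ = LinearMap.id)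
  apply chain_hom_ext
  intro x m
  simp [h, h']

end Hochschild.PairHom

/-! ### Idempotent relations in the triangular algebra -/

section triangular

variable (k : Type u) [CommRing k] (A B M : Type u) [Ring A] [Ring B] [Algebra k A] [Algebra k B]
  [AddCommGroup M] [Module k M] [Module A M] [Module Bᵐᵒᵖ M] [SMulCommClass A Bᵐᵒᵖ M]
  [IsScalarTower k A M] [IsScalarTower k Bᵐᵒᵖ M]
  (X : Type u) [AddCommGroup X] [Module k X] [Module (TriAlg A B M) X]
  [Module (TriAlg A B M)ᵐᵒᵖ X] [SMulCommClass (TriAlg A B M) (TriAlg A B M)ᵐᵒᵖ X]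
  [IsScalarTower k (TriAlg A B M) X] [IsScalarTower k (TriAlg A B M)ᵐᵒᵖ X]

/-- This expresses 1_B E 1_A = 0. It makes 1_A X stable under E and is the condition under which
compression by 1_A is homotopic to the identity. -/
theorem TriAlg.eA_mul_mul_eA (e : TriAlg A B M) :
    TriAlg.eA A B M * (e * TriAlg.eA A B M) = e * TriAlg.eA A B M := by
  ext <;> simp [TriAlg.eA, TriAlg.inA]

theorem TriAlg.mul_eA (e : TriAlg A B M) : e * TriAlg.eA A B M = TriAlg.inA e.a := by
  ext <;> simp [TriAlg.eA, TriAlg.inA]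

/-- The bottom row of e is π(e) alone; hence x ↦ 1_B x is E-linear when E acts on 1_B X through π.
-/
theorem TriAlg.eB_mul (e : TriAlg A B M) : TriAlg.eB A B M * e = TriAlg.inB e.b := by
  ext <;> simp [TriAlg.eB, TriAlg.inB]

theorem TriAlg.inB_mul_eB (b : B) :
    (TriAlg.inB b : TriAlg A B M) * TriAlg.eB A B M = TriAlg.inB b := by
  ext <;> simp [TriAlg.eB, TriAlg.inB]

theorem TriAlg.eA_add_eB : TriAlg.eA A B M + TriAlg.eB A B M = 1 := by
  ext <;> simp [TriAlg.eA, TriAlg.eB, TriAlg.inA, TriAlg.inB]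

theorem TriAlg.eB_mul_eA : TriAlg.eB A B M * TriAlg.eA A B M = 0 := by
  ext <;> simp [TriAlg.eA, TriAlg.eB, TriAlg.inA, TriAlg.inB]

/-! ## The bimodule `1_A X` -/

/-- `1_A X`, as a `k`-submodule of `X`. -/
def cornerA : Submodule k X :=
  LinearMap.range (Hochschild.lAct k (TriAlg A B M) X (TriAlg.eA A B M))

/-- `1_A X`, as an `E`-bimodule. -/
def AX : Type u := cornerA k A B M X

instance : AddCommGroup (AX k A B M X) := inferInstanceAs (AddCommGroup (cornerA k A B M X))
instance : Module k (AX k A B M X) := inferInstanceAs (Module k (cornerA k A B M X))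

/-- The inclusion `1_A X → X`. -/
def AX.incl : AX k A B M X →ₗ[k] X := (cornerA k A B M X).subtype

theorem AX.incl_injective : Function.Injective (AX.incl k A B M X) := Subtype.val_injective

theorem cornerA_lsmul (e : TriAlg A B M) (x : X) (hx : x ∈ cornerA k A B M X) :
    e • x ∈ cornerA k A B M X := by
  obtain ⟨y, rfl⟩ := hx
  refine ⟨e • TriAlg.eA A B M • y, ?_⟩
  simp only [Hochschild.lAct_apply, ← mul_smul, TriAlg.eA_mul_mul_eA]

theorem cornerA_rsmul (e : (TriAlg A B M)ᵐᵒᵖ) (x : X) (hx : x ∈ cornerA k A B M X) :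
    e • x ∈ cornerA k A B M X := by
  obtain ⟨y, rfl⟩ := hx
  exact ⟨e • y, smul_comm _ _ _⟩

theorem AX.one_lsmul (x : AX k A B M X) :
    (TriAlg.eA A B M) • AX.incl k A B M X x = AX.incl k A B M X x := by
  obtain ⟨_, y, rfl⟩ := x
  change TriAlg.eA A B M • TriAlg.eA A B M • y = TriAlg.eA A B M • y
  rw [← mul_smul, TriAlg.inA_mul, one_mul]

instance : SMul (TriAlg A B M) (AX k A B M X) :=
  ⟨fun e x => ⟨e • x.1, cornerA_lsmul k A B M X e x.1 x.2⟩⟩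

instance : SMul (TriAlg A B M)ᵐᵒᵖ (AX k A B M X) :=
  ⟨fun e x => ⟨e • x.1, cornerA_rsmul k A B M X e x.1 x.2⟩⟩

theorem AX.incl_lsmul (e : TriAlg A B M) (x : AX k A B M X) :
    AX.incl k A B M X (e • x) = e • AX.incl k A B M X x := rfl

theorem AX.incl_rsmul (e : (TriAlg A B M)ᵐᵒᵖ) (x : AX k A B M X) :
    AX.incl k A B M X (e • x) = e • AX.incl k A B M X x := rfl

instance : Module (TriAlg A B M) (AX k A B M X) :=
  Function.Injective.module _ (AX.incl k A B M X).toAddMonoidHom (AX.incl_injective k A B M X)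
    (AX.incl_lsmul k A B M X)

instance : Module (TriAlg A B M)ᵐᵒᵖ (AX k A B M X) :=
  Function.Injective.module _ (AX.incl k A B M X).toAddMonoidHom (AX.incl_injective k A B M X)
    (AX.incl_rsmul k A B M X)

instance : SMulCommClass (TriAlg A B M) (TriAlg A B M)ᵐᵒᵖ (AX k A B M X) :=
  ⟨fun a b x => AX.incl_injective k A B M X (smul_comm a b (AX.incl k A B M X x))⟩

instance : IsScalarTower k (TriAlg A B M) (AX k A B M X) :=
  ⟨fun c a x => AX.incl_injective k A B M X (smul_assoc c a (AX.incl k A B M X x))⟩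

instance : IsScalarTower k (TriAlg A B M)ᵐᵒᵖ (AX k A B M X) :=
  ⟨fun c a x => AX.incl_injective k A B M X (smul_assoc c a (AX.incl k A B M X x))⟩

/-- The projection `x ↦ 1_A x` of `X` onto `1_A X`. -/
def AX.proj : X →ₗ[k] AX k A B M X :=
  LinearMap.rangeRestrict (Hochschild.lAct k (TriAlg A B M) X (TriAlg.eA A B M))

theorem AX.incl_proj (x : X) :
    AX.incl k A B M X (AX.proj k A B M X x) = TriAlg.eA A B M • x := rfl

/-- The inclusion of `A` as a corner of `E`. -/
def TriAlg.inAHom : A →ₙₐ[k] TriAlg A B M where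
  toFun := TriAlg.inA
  map_smul' c a := by ext <;> simp [TriAlg.inA]
  map_zero' := rfl
  map_add' := TriAlg.inA_add
  map_mul' a b := (TriAlg.inA_mul a b).symm

/-- The projection of `E` onto `A`. -/
def TriAlg.toAHom : TriAlg A B M →ₙₐ[k] A where
  toFun e := e.a
  map_smul' _ _ := rfl
  map_zero' := rfl
  map_add' _ _ := rfl
  map_mul' _ _ := rfl

/-- The inclusion of the pair `(A, X_AA)` in `(E, 1_A X)`. -/
def cornerInclusion :
    Hochschild.PairHom k A (XAA k A B M X) (TriAlg A B M) (AX k A B M X) where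
  alg := TriAlg.inAHom k A B M
  -- Since 1_A fixes X_AA, this is the plain inclusion; the projection only serves to land in 1_A X.
  mod := (AX.proj k A B M X).comp (XAA.incl k A B M X)
  map_lsmul a x := AX.incl_injective k A B M X (by
    rw [LinearMap.comp_apply, AX.incl_proj, XAA.one_lsmul, AX.incl_lsmul, LinearMap.comp_apply,
      AX.incl_proj, XAA.one_lsmul, XAA.incl_lsmul]
    rfl)
  map_rsmul a x := AX.incl_injective k A B M X (by
    rw [LinearMap.comp_apply, AX.incl_proj, XAA.one_lsmul, AX.incl_rsmul, LinearMap.comp_apply,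
      AX.incl_proj, XAA.one_lsmul, XAA.incl_rsmul]
    rfl)

/-- The projection `x ↦ x 1_A` of `1_A X` onto `X_AA`. -/
def AX.toXAA : AX k A B M X →ₗ[k] XAA k A B M X :=
  (LinearMap.rangeRestrict (Hochschild.rAct k (TriAlg A B M) X (TriAlg.eA A B M) ∘ₗ
    Hochschild.lAct k (TriAlg A B M) X (TriAlg.eA A B M))).comp (AX.incl k A B M X)

theorem AX.incl_toXAA (x : AX k A B M X) :
    XAA.incl k A B M X (AX.toXAA k A B M X x) = op (TriAlg.eA A B M) • AX.incl k A B M X x :=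
  congrArg (op (TriAlg.eA A B M) • ·) (AX.one_lsmul k A B M X x)

/-- The projection of the pair `(E, 1_A X)` onto `(A, X_AA)`. -/
def cornerProjection :
    Hochschild.PairHom k (TriAlg A B M) (AX k A B M X) A (XAA k A B M X) where
  alg := TriAlg.toAHom k A B M
  mod := AX.toXAA k A B M X
  map_lsmul e x := XAA.incl_injective k A B M X (by
    rw [AX.incl_toXAA, AX.incl_lsmul, XAA.incl_lsmul, AX.incl_toXAA]
    -- Writing x = 1_A x replaces e by e 1_A, which retains only the A-entry of e.
    conv_lhs => rw [← AX.one_lsmul, ← mul_smul, TriAlg.mul_eA, ← smul_comm]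
    rfl)
  map_rsmul e x := XAA.incl_injective k A B M X (by
    rw [AX.incl_toXAA, AX.incl_rsmul, XAA.incl_rsmul, AX.incl_toXAA, ← mul_smul, ← mul_smul,
      ← op_mul, TriAlg.mul_eA, unop_op, ← op_mul, TriAlg.inA_mul, one_mul]
    rfl)

/-- `H_n(A, X_AA) ≅ H_n(E, 1_A X)`. -/
def cornerHomologyIso (n : ℕ) :
    Hochschild.homology k A (XAA k A B M X) n
      ≅ Hochschild.homology k (TriAlg A B M) (AX k A B M X) n where
  hom := HomologicalComplex.homologyMap (cornerInclusion k A B M X).complexMap n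
  inv := HomologicalComplex.homologyMap (cornerProjection k A B M X).complexMap n
  hom_inv_id := by
    rw [← HomologicalComplex.homologyMap_comp, ← Hochschild.PairHom.complexMap_comp,
      Hochschild.PairHom.complexMap_eq_id _ (fun _ => rfl)
        (fun x => XAA.incl_injective k A B M X ?_),
      HomologicalComplex.homologyMap_id]
    change XAA.incl k A B M X (AX.toXAA k A B M X (AX.proj k A B M X (XAA.incl k A B M X x))) = _
    rw [AX.incl_toXAA, AX.incl_proj, XAA.one_lsmul, XAA.one_rsmul]
  inv_hom_id := by
    rw [← HomologicalComplex.homologyMap_comp, ← Hochschild.PairHom.complexMap_comp]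
    -- This round trip is e ↦ e 1_A on the algebra and x ↦ x 1_A on coefficients, because e 1_A is
    -- the A-entry of e placed in its corner.
    refine Hochschild.homologyMap_compress (e := TriAlg.eA A B M) (TriAlg.eA_mul_mul_eA A B M)
      (fun x => AX.incl_injective k A B M X (AX.one_lsmul k A B M X x)) _
      (fun e => (TriAlg.mul_eA A B M e).symm) (fun x => AX.incl_injective k A B M X ?_) n
    change AX.incl k A B M X (AX.proj k A B M X (XAA.incl k A B M X (AX.toXAA k A B M X x))) = _
    rw [AX.incl_proj, XAA.one_lsmul, AX.incl_toXAA]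
    rfl

/-! ## The bimodule `1_B X` and the long exact sequence -/

/-- `E` acts on the left of `1_B X` through `π`. -/
instance : Module (TriAlg A B M) (BX k A B M X) :=
  Module.compHom (BX k A B M X) (TriAlg.toB (A := A) (M := M))

theorem BX.tri_smul (e : TriAlg A B M) (x : BX k A B M X) : e • x = e.b • x := rfl

instance : SMulCommClass (TriAlg A B M) (TriAlg A B M)ᵐᵒᵖ (BX k A B M X) :=
  ⟨fun a b x => (smul_comm b a.b x).symm⟩

instance : IsScalarTower k (TriAlg A B M) (BX k A B M X) :=
  ⟨fun c a x => smul_assoc c a.b x⟩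

/-- The projection `x ↦ 1_B x` of `X` onto `1_B X`. -/
def BX.proj : X →ₗ[k] BX k A B M X :=
  LinearMap.rangeRestrict (Hochschild.lAct k (TriAlg A B M) X (TriAlg.eB A B M))

theorem BX.incl_proj (x : X) :
    BX.incl k A B M X (BX.proj k A B M X x) = TriAlg.eB A B M • x := rfl

theorem BX.proj_incl (x : BX k A B M X) : BX.proj k A B M X (BX.incl k A B M X x) = x :=
  BX.incl_injective k A B M X (BX.one_lsmul k A B M X x)

theorem AX.proj_incl (x : AX k A B M X) : AX.proj k A B M X (AX.incl k A B M X x) = x :=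
  AX.incl_injective k A B M X (AX.one_lsmul k A B M X x)

theorem BX.proj_AX_incl (x : AX k A B M X) : BX.proj k A B M X (AX.incl k A B M X x) = 0 :=
  BX.incl_injective k A B M X (by
    rw [BX.incl_proj, ← AX.one_lsmul, ← mul_smul, TriAlg.eB_mul_eA, zero_smul, map_zero])

theorem AX.incl_proj_add (x : X) :
    AX.incl k A B M X (AX.proj k A B M X x) + BX.incl k A B M X (BX.proj k A B M X x) = x := by
  rw [AX.incl_proj, BX.incl_proj, ← add_smul, TriAlg.eA_add_eB, one_smul]

/-- The inclusion `1_A X → X`, as a morphism of pairs over `E`. -/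
def AX.inclPair : Hochschild.PairHom k (TriAlg A B M) (AX k A B M X) (TriAlg A B M) X :=
  .ofBimoduleMap (AX.incl k A B M X) (AX.incl_lsmul k A B M X)
    (fun c => AX.incl_rsmul k A B M X (op c))

/-- The projection `X → 1_B X`, as a morphism of pairs over `E`. -/
def BX.projPair : Hochschild.PairHom k (TriAlg A B M) X (TriAlg A B M) (BX k A B M X) :=
  .ofBimoduleMap (BX.proj k A B M X)
    (fun e x => BX.incl_injective k A B M X (by
      rw [BX.incl_proj, BX.tri_smul, BX.incl_lsmul, BX.incl_proj, ← mul_smul, ← mul_smul,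
        TriAlg.eB_mul, TriAlg.inB_mul_eB]))
    (fun e x => BX.incl_injective k A B M X (by
      rw [BX.incl_proj, BX.incl_rsmul, BX.incl_proj, smul_comm]))

/-- The short complex `C_*(E, 1_A X) ⟶ C_*(E, X) ⟶ C_*(E, 1_B X)`. -/
def cornerShortComplex : ShortComplex (ChainComplex (ModuleCat.{u} k) ℕ) :=
  ShortComplex.mk (AX.inclPair k A B M X).complexMap (BX.projPair k A B M X).complexMap (by
    ext n : 1
    refine congrArg ModuleCat.ofHom
      (?_ : ((BX.projPair k A B M X).chainMap n).comp ((AX.inclPair k A B M X).chainMap n) = 0)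
    rw [AX.inclPair, BX.projPair, Hochschild.PairHom.ofBimoduleMap_chainMap,
      Hochschild.PairHom.ofBimoduleMap_chainMap, ← LinearMap.rTensor_comp]
    rw [show (BX.proj k A B M X).comp (AX.incl k A B M X) = 0 from
      LinearMap.ext (BX.proj_AX_incl k A B M X), LinearMap.rTensor_zero])

/-- The map x ↦ 1_A x and the inclusion of 1_B X split the coefficient sequence over k. Tensoring
preserves a splitting, so no flatness of E over k is required. -/
theorem cornerShortComplex_shortExact : (cornerShortComplex k A B M X).ShortExact := by
  refine HomologicalComplex.shortExact_of_degreewise_shortExact _ fun n => ?_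
  refine ShortComplex.Splitting.shortExact
    { r := ModuleCat.ofHom ((AX.proj k A B M X).rTensor (⨂[k]^n (TriAlg A B M)))
      s := ModuleCat.ofHom ((BX.incl k A B M X).rTensor (⨂[k]^n (TriAlg A B M)))
      f_r := ?_
      s_g := ?_
      id := ?_ }
  · refine congrArg ModuleCat.ofHom (?_ : (LinearMap.rTensor _ _).comp
      ((AX.inclPair k A B M X).chainMap n) = LinearMap.id)
    rw [AX.inclPair, Hochschild.PairHom.ofBimoduleMap_chainMap, ← LinearMap.rTensor_comp,
      show (AX.proj k A B M X).comp (AX.incl k A B M X) = LinearMap.id from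
        LinearMap.ext (AX.proj_incl k A B M X), LinearMap.rTensor_id]
  · refine congrArg ModuleCat.ofHom (?_ : ((BX.projPair k A B M X).chainMap n).comp
      (LinearMap.rTensor _ _) = LinearMap.id)
    rw [BX.projPair, Hochschild.PairHom.ofBimoduleMap_chainMap, ← LinearMap.rTensor_comp,
      show (BX.proj k A B M X).comp (BX.incl k A B M X) = LinearMap.id from
        LinearMap.ext (BX.proj_incl k A B M X), LinearMap.rTensor_id]
  · refine congrArg ModuleCat.ofHom (?_ :
      ((AX.inclPair k A B M X).chainMap n).comp (LinearMap.rTensor _ _)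
        + (LinearMap.rTensor _ _).comp ((BX.projPair k A B M X).chainMap n) = LinearMap.id)
    rw [AX.inclPair, BX.projPair, Hochschild.PairHom.ofBimoduleMap_chainMap,
      Hochschild.PairHom.ofBimoduleMap_chainMap, ← LinearMap.rTensor_comp,
      ← LinearMap.rTensor_comp, ← LinearMap.rTensor_add,
      show (AX.incl k A B M X).comp (AX.proj k A B M X)
        + (BX.incl k A B M X).comp (BX.proj k A B M X) = LinearMap.id from
        LinearMap.ext (AX.incl_proj_add k A B M X), LinearMap.rTensor_id]

end triangular

section bar

variable (k : Type u) [CommRing k] (A B M : Type u) [Ring A] [Ring B] [Algebra k A] [Algebra k B]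
  [AddCommGroup M] [Module k M] [Module A M] [Module Bᵐᵒᵖ M] [SMulCommClass A Bᵐᵒᵖ M]
  [IsScalarTower k A M] [IsScalarTower k Bᵐᵒᵖ M]

/-! ## The bar resolution of `B_E` -/

/-- `E ⊗ B`, as an `E`-bimodule by `e (e₀ ⊗ b) e' = e₀ e' ⊗ π(e) b`; it commutes with the left
multiplication of `E ⊗ B^op`. -/
def BarCoeff : Type u := TriAlg A B M ⊗[k] Bᵐᵒᵖ

instance : AddCommGroup (BarCoeff k A B M) :=
  inferInstanceAs (AddCommGroup (TriAlg A B M ⊗[k] Bᵐᵒᵖ))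
instance : Module k (BarCoeff k A B M) := inferInstanceAs (Module k (TriAlg A B M ⊗[k] Bᵐᵒᵖ))
instance : Module (TriAlg A B M ⊗[k] Bᵐᵒᵖ) (BarCoeff k A B M) :=
  inferInstanceAs (Module (TriAlg A B M ⊗[k] Bᵐᵒᵖ) (TriAlg A B M ⊗[k] Bᵐᵒᵖ))
instance : IsScalarTower k (TriAlg A B M ⊗[k] Bᵐᵒᵖ) (BarCoeff k A B M) :=
  inferInstanceAs (IsScalarTower k (TriAlg A B M ⊗[k] Bᵐᵒᵖ) (TriAlg A B M ⊗[k] Bᵐᵒᵖ))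

/-- The elements of `E ⊗ B^op`, as elements of the bimodule. -/
def BarCoeff.of : (TriAlg A B M ⊗[k] Bᵐᵒᵖ) ≃ₗ[TriAlg A B M ⊗[k] Bᵐᵒᵖ] BarCoeff k A B M :=
  LinearEquiv.refl _ _

/-- The element `1 ⊗ π(e)` of `E ⊗ B^op`, as an element of the opposite ring. -/
def TriAlg.rightFactor : TriAlg A B M →+* (TriAlg A B M ⊗[k] Bᵐᵒᵖ)ᵐᵒᵖ where
  toFun e := op (1 ⊗ₜ op e.b)
  map_one' := rfl
  map_mul' e e' := by
    rw [← op_mul, Algebra.TensorProduct.tmul_mul_tmul, one_mul]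
    rfl
  map_zero' := congrArg op (TensorProduct.tmul_zero _ _)
  map_add' e e' := congrArg op (TensorProduct.tmul_add _ _ _)

/-- Both E-actions are right multiplications in E ⊗ B^op, and so commute with left multiplication by
E ⊗ B^op. Multiplying on the right by 1 ⊗ π(e) is a left action because the second factor is
opposite. -/
instance : Module (TriAlg A B M) (BarCoeff k A B M) :=
  Module.compHom (TriAlg A B M ⊗[k] Bᵐᵒᵖ) (TriAlg.rightFactor k A B M)

instance : Module (TriAlg A B M)ᵐᵒᵖ (BarCoeff k A B M) :=
  Module.compHom (TriAlg A B M ⊗[k] Bᵐᵒᵖ)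
    (RingHom.op (Algebra.TensorProduct.includeLeftRingHom :
      TriAlg A B M →+* TriAlg A B M ⊗[k] Bᵐᵒᵖ))

theorem BarCoeff.lsmul_of (e : TriAlg A B M) (r : TriAlg A B M ⊗[k] Bᵐᵒᵖ) :
    e • BarCoeff.of k A B M r = BarCoeff.of k A B M (r * (1 ⊗ₜ op e.b)) := rfl

theorem BarCoeff.rsmul_of (e : TriAlg A B M) (r : TriAlg A B M ⊗[k] Bᵐᵒᵖ) :
    op e • BarCoeff.of k A B M r = BarCoeff.of k A B M (r * (e ⊗ₜ 1)) := rfl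

theorem BarCoeff.smul_of (s r : TriAlg A B M ⊗[k] Bᵐᵒᵖ) :
    s • BarCoeff.of k A B M r = BarCoeff.of k A B M (s * r) := rfl

theorem BarCoeff.smul_base_of (c : k) (r : TriAlg A B M ⊗[k] Bᵐᵒᵖ) :
    c • BarCoeff.of k A B M r = BarCoeff.of k A B M (c • r) := rfl

instance : SMulCommClass (TriAlg A B M) (TriAlg A B M)ᵐᵒᵖ (BarCoeff k A B M) :=
  ⟨fun a b r => by
    obtain ⟨r, rfl⟩ := (BarCoeff.of k A B M).surjective r
    induction b using MulOpposite.rec' with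
    | _ b =>
      simp only [BarCoeff.lsmul_of, BarCoeff.rsmul_of, mul_assoc,
        Algebra.TensorProduct.tmul_mul_tmul, one_mul, mul_one]⟩

instance : IsScalarTower k (TriAlg A B M) (BarCoeff k A B M) :=
  ⟨fun c a r => by
    obtain ⟨r, rfl⟩ := (BarCoeff.of k A B M).surjective r
    simp only [BarCoeff.lsmul_of, BarCoeff.smul_base_of, TriAlg.smul_b, op_smul,
      TensorProduct.tmul_smul, mul_smul_comm]⟩

instance : IsScalarTower k (TriAlg A B M)ᵐᵒᵖ (BarCoeff k A B M) :=
  ⟨fun c a r => by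
    obtain ⟨r, rfl⟩ := (BarCoeff.of k A B M).surjective r
    induction a using MulOpposite.rec' with
    | _ a =>
      simp only [← op_smul, BarCoeff.rsmul_of, BarCoeff.smul_base_of, TensorProduct.smul_tmul',
        ← mul_smul_comm]⟩

instance : SMulCommClass (TriAlg A B M ⊗[k] Bᵐᵒᵖ) (TriAlg A B M) (BarCoeff k A B M) :=
  ⟨fun s _ r => (mul_assoc s (show TriAlg A B M ⊗[k] Bᵐᵒᵖ from r) _).symm⟩

instance : SMulCommClass (TriAlg A B M ⊗[k] Bᵐᵒᵖ) (TriAlg A B M)ᵐᵒᵖ (BarCoeff k A B M) :=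
  ⟨fun s _ r => (mul_assoc s (show TriAlg A B M ⊗[k] Bᵐᵒᵖ from r) _).symm⟩

/-- The terms `(E ⊗ B) ⊗ E^{⊗ n}` of the bar resolution. -/
abbrev BarTerm (n : ℕ) : Type u := Hochschild.Chain k (TriAlg A B M) (BarCoeff k A B M) n

theorem BarTerm.hom_ext {n : ℕ} {Z : Type u} [AddCommGroup Z] [Module k Z]
    {f g : BarTerm k A B M n →ₗ[k] Z}
    (h : ∀ e b m, f (BarCoeff.of k A B M (e ⊗ₜ op b) ⊗ₜ PiTensorProduct.tprod k m)
      = g (BarCoeff.of k A B M (e ⊗ₜ op b) ⊗ₜ PiTensorProduct.tprod k m)) : f = g := by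
  apply Hochschild.chain_hom_ext
  intro r m
  obtain ⟨r, rfl⟩ := (BarCoeff.of k A B M).surjective r
  induction r using TensorProduct.induction_on with
  | zero => simp
  | add r s hr hs => simp only [map_add, TensorProduct.add_tmul, hr, hs]
  | tmul e b => exact h e b.unop m

/-- The differential of the bar resolution. -/
def barD (n : ℕ) : BarTerm k A B M (n + 1) →ₗ[TriAlg A B M ⊗[k] Bᵐᵒᵖ] BarTerm k A B M n where
  toFun := Hochschild.boundary k (TriAlg A B M) (BarCoeff k A B M) n
  map_add' := map_add _
  map_smul' r t := by
    -- Left multiplication by r is an endomorphism of the coefficient bimodule, so linearity of the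
    -- differential is naturality of the Hochschild boundary.
    let F : Hochschild.PairHom k (TriAlg A B M) (BarCoeff k A B M) (TriAlg A B M)
        (BarCoeff k A B M) :=
      .ofBimoduleMap (Algebra.lsmul k k _ r) (fun c x => smul_comm r c x)
        (fun c x => smul_comm r (op c) x)
    have hF : ∀ n t, F.chainMap n t = r • t := fun n t =>
      LinearMap.congr_fun (Hochschild.PairHom.ofBimoduleMap_chainMap _ _ _ n) t
    have h := LinearMap.congr_fun (F.boundary_chainMap n) t
    rw [LinearMap.comp_apply, LinearMap.comp_apply, hF, hF] at h
    exact h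

/-- The augmentation of the bar resolution. -/
def barAug : BarTerm k A B M 0 →ₗ[TriAlg A B M ⊗[k] Bᵐᵒᵖ] BE A B M :=
  (LinearMap.toSpanSingleton _ (BE A B M) (show BE A B M from (1 : B))).comp
    ((TensorProduct.AlgebraTensorModule.rid k (TriAlg A B M ⊗[k] Bᵐᵒᵖ)
      (TriAlg A B M ⊗[k] Bᵐᵒᵖ)).toLinearMap.comp
    (TensorProduct.AlgebraTensorModule.map (BarCoeff.of k A B M).symm.toLinearMap
      (PiTensorProduct.isEmptyEquiv (Fin 0)).toLinearMap))

theorem barAug_tmul_tprod (e : TriAlg A B M) (b : B) (m : Fin 0 → TriAlg A B M) :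
    barAug k A B M (BarCoeff.of k A B M (e ⊗ₜ op b) ⊗ₜ PiTensorProduct.tprod k m)
      = (show BE A B M from e.b * b) := by
  simp only [barAug, LinearMap.comp_apply, LinearEquiv.coe_coe,
    TensorProduct.AlgebraTensorModule.map_tmul, PiTensorProduct.isEmptyEquiv_apply_tprod,
    TensorProduct.AlgebraTensorModule.rid_tmul, one_smul, LinearEquiv.symm_apply_apply]
  exact (BE.tmul_smul k A B M e b 1).trans (congrArg (· * b) (mul_one e.b))

/-- Prepending a factor to a tensor. -/
def consTensor (C : Type u) [Ring C] [Algebra k C] (n : ℕ) :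
    C →ₗ[k] (⨂[k]^n C) →ₗ[k] (⨂[k]^(n + 1) C) :=
  (PiTensorProduct.lift (R := k)).toLinearMap.comp
    (PiTensorProduct.tprod k (s := fun _ : Fin (n + 1) => C)).curryLeft

theorem consTensor_tprod (C : Type u) [Ring C] [Algebra k C] (n : ℕ) (c : C) (m : Fin n → C) :
    consTensor k C n c (PiTensorProduct.tprod k m) = PiTensorProduct.tprod k (Fin.cons c m) := by
  simp [consTensor]

/-- The contraction `(e₀ ⊗ b) ⊗ e₁ ⊗ ⋯ ⊗ eₙ ↦ (1 ⊗ b) ⊗ e₀ ⊗ ⋯ ⊗ eₙ` of the bar resolution. -/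
def barContraction (n : ℕ) : BarTerm k A B M n →ₗ[k] BarTerm k A B M (n + 1) :=
  (TensorProduct.map
    (((BarCoeff.of k A B M).toLinearMap.restrictScalars k).comp
      (TensorProduct.mk k (TriAlg A B M) Bᵐᵒᵖ 1))
    (TensorProduct.lift (consTensor k (TriAlg A B M) n))).comp
  ((TensorProduct.assoc k Bᵐᵒᵖ (TriAlg A B M) (⨂[k]^n (TriAlg A B M))).toLinearMap.comp
    (LinearMap.rTensor _ ((TensorProduct.comm k (TriAlg A B M) Bᵐᵒᵖ).toLinearMap.comp
      ((BarCoeff.of k A B M).symm.toLinearMap.restrictScalars k))))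

theorem barContraction_tmul_tprod (n : ℕ) (e : TriAlg A B M) (b : B)
    (m : Fin n → TriAlg A B M) :
    barContraction k A B M n (BarCoeff.of k A B M (e ⊗ₜ op b) ⊗ₜ PiTensorProduct.tprod k m)
      = BarCoeff.of k A B M (1 ⊗ₜ op b)
        ⊗ₜ PiTensorProduct.tprod k (Fin.cons e m : Fin (n + 1) → TriAlg A B M) := by
  rw [← consTensor_tprod]
  rfl

/-- The contraction is an extra degeneracy: the zeroth face puts e₀ back, as (1 ⊗ b) e₀ = e₀ ⊗ b. -/
theorem face_zero_barContraction (n : ℕ) :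
    (Hochschild.face k (TriAlg A B M) (BarCoeff k A B M) n 0).comp (barContraction k A B M n)
      = LinearMap.id := by
  apply BarTerm.hom_ext
  intro e b m
  have h : Hochschild.faceC (TriAlg A B M) (0 : Fin (n + 2))
      (Fin.cons e m : Fin (n + 1) → _) = m := by
    ext1 q
    simp [Hochschild.faceC]
  simp only [LinearMap.comp_apply, barContraction_tmul_tprod, Hochschild.face_tmul_tprod, h,
    LinearMap.id_apply]
  simp [Hochschild.faceX, BarCoeff.rsmul_of]

/-- Moving e₀ out of the coefficient shifts every face by one. Right multiplication of the
coefficient becomes the product of the first two factors, while the last face only touches the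
B-factor, which stays in place. -/
theorem face_succ_barContraction (n : ℕ) (i : Fin (n + 2)) :
    (Hochschild.face k (TriAlg A B M) (BarCoeff k A B M) (n + 1) i.succ).comp
        (barContraction k A B M (n + 1))
      = (barContraction k A B M n).comp
        (Hochschild.face k (TriAlg A B M) (BarCoeff k A B M) n i) := by
  apply BarTerm.hom_ext
  intro e b m
  simp only [LinearMap.comp_apply, barContraction_tmul_tprod, Hochschild.face_tmul_tprod]
  by_cases h0 : i = 0
  · subst h0
    simp only [Hochschild.faceX, Fin.val_zero, if_true, BarCoeff.rsmul_of,
      Algebra.TensorProduct.tmul_mul_tmul, mul_one, barContraction_tmul_tprod]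
    simp only [Fin.val_succ, Fin.val_zero, zero_add, one_ne_zero, if_false]
    congr 2
    ext1 q
    induction q using Fin.cases with
    | zero => simp [Hochschild.faceC]
    | succ q => simp [Hochschild.faceC]
  · have h0' : i.val ≠ 0 := fun h => h0 (Fin.ext h)
    have hC : Hochschild.faceC (TriAlg A B M) i.succ (Fin.cons e m : Fin (n + 2) → _)
        = Fin.cons e (Hochschild.faceC (TriAlg A B M) i m) := by
      ext1 q
      induction q using Fin.cases with
      | zero =>
        have : 0 < i.val := by omega
        simp [Hochschild.faceC, this]
      | succ q => simp [Hochschild.faceC]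
    rw [hC]
    by_cases hl : i.val = n + 1
    · have h1 : (Fin.cons e m : Fin (n + 2) → TriAlg A B M) (Fin.last (n + 1))
          = m (Fin.last n) := by
        rw [← Fin.succ_last, Fin.cons_succ]
      simp only [Hochschild.faceX, Fin.val_succ, hl, if_true, if_false, h1,
        Nat.succ_ne_zero, BarCoeff.lsmul_of, Algebra.TensorProduct.tmul_mul_tmul, mul_one,
        ← op_mul, barContraction_tmul_tprod]
    · have hl' : i.val + 1 ≠ n + 1 + 1 := by omega
      simp only [Hochschild.faceX, Fin.val_succ, h0', hl, hl', if_false,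
        Nat.succ_ne_zero, barContraction_tmul_tprod]

theorem boundary_barContraction_succ (n : ℕ) (t : BarTerm k A B M (n + 1)) :
    barD k A B M (n + 1) (barContraction k A B M (n + 1) t)
      + barContraction k A B M n (barD k A B M n t) = t := by
  change Hochschild.boundary k _ _ (n + 1) _
    + barContraction k A B M n (Hochschild.boundary k _ _ n t) = t
  simp only [Hochschild.boundary, LinearMap.sum_apply, LinearMap.smul_apply, map_sum, map_zsmul]
  -- Only the zeroth face remains: face i + 1 after the contraction cancels the contraction after
  -- face i, their signs being opposite.
  rw [Fin.sum_univ_succ, add_assoc, ← Finset.sum_add_distrib, Finset.sum_eq_zero, add_zero]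
  · rw [Fin.val_zero, pow_zero, one_smul]
    exact LinearMap.congr_fun (face_zero_barContraction k A B M (n + 1)) t
  · intro i _
    have h := LinearMap.congr_fun (face_succ_barContraction k A B M n i) t
    rw [LinearMap.comp_apply, LinearMap.comp_apply] at h
    rw [h, Fin.val_succ, pow_succ, mul_neg_one, neg_smul, neg_add_cancel]

/-- The section `y ↦ 1 ⊗ y` of the augmentation. -/
def barSection : BE A B M →ₗ[k] BarTerm k A B M 0 :=
  ((TensorProduct.mk k (BarCoeff k A B M) (⨂[k]^0 (TriAlg A B M))).flip
      (PiTensorProduct.tprod k Fin.elim0)).comp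
    (((BarCoeff.of k A B M).toLinearMap.restrictScalars k).comp
      ((TensorProduct.mk k (TriAlg A B M) Bᵐᵒᵖ 1).comp
        (opLinearEquiv k : B ≃ₗ[k] Bᵐᵒᵖ).toLinearMap))

theorem barSection_apply (y : B) :
    barSection k A B M (show BE A B M from y)
      = BarCoeff.of k A B M (1 ⊗ₜ op y) ⊗ₜ PiTensorProduct.tprod k Fin.elim0 := rfl

theorem barD_zero_tmul_tprod (e : TriAlg A B M) (b : B) (m : Fin 1 → TriAlg A B M) :
    barD k A B M 0 (BarCoeff.of k A B M (e ⊗ₜ op b) ⊗ₜ PiTensorProduct.tprod k m)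
      = BarCoeff.of k A B M ((e * m 0) ⊗ₜ op b) ⊗ₜ PiTensorProduct.tprod k Fin.elim0
        - BarCoeff.of k A B M (e ⊗ₜ op ((m 0).b * b)) ⊗ₜ PiTensorProduct.tprod k Fin.elim0 := by
  change Hochschild.boundary k _ _ 0 _ = _
  have h : ∀ i, Hochschild.faceC (TriAlg A B M) i m = Fin.elim0 := fun i => Subsingleton.elim _ _
  simp only [Hochschild.boundary, LinearMap.sum_apply, LinearMap.smul_apply,
    Hochschild.face_tmul_tprod, h]
  simp [Hochschild.faceX, BarCoeff.lsmul_of, BarCoeff.rsmul_of, sub_eq_add_neg]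

/-- The bar resolution of `B_E`. -/
def barResolution : RelProjResolution k (TriAlg A B M ⊗[k] Bᵐᵒᵖ) (BE A B M) where
  P := BarTerm k A B M
  d := barD k A B M
  ε := barAug k A B M
  ε_comp_d := by
    apply LinearMap.restrictScalars_injective k
    apply BarTerm.hom_ext
    intro e b m
    change barAug k A B M (barD k A B M 0 _) = 0
    rw [barD_zero_tmul_tprod, map_sub, barAug_tmul_tprod, barAug_tmul_tprod, TriAlg.mul_b,
      mul_assoc]
    exact sub_self _
  d_comp_d n := LinearMap.ext fun t =>
    LinearMap.congr_fun (Hochschild.boundary_comp_boundary k (TriAlg A B M) (BarCoeff k A B M) n) t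
  -- Each term is by definition (E ⊗ B^op) ⊗ V with V = E^{⊗n}, a module induced from k.
  relProjective n := isRelProjective_tensor k (TriAlg A B M ⊗[k] Bᵐᵒᵖ) _
  contractible := by
    refine ⟨barSection k A B M, barContraction k A B M, ?_, ?_,
      boundary_barContraction_succ k A B M⟩
    · exact fun y => (barAug_tmul_tprod k A B M 1 y _).trans (one_mul (show B from y))
    -- On e ⊗ b the differential of the contraction is e ⊗ b - 1 ⊗ π(e) b, and the section after the
    -- augmentation restores the second term.
    · refine LinearMap.congr_fun (f := ((barD k A B M 0).restrictScalars k).comp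
        (barContraction k A B M 0)
        + (barSection k A B M).comp ((barAug k A B M).restrictScalars k)) (g := LinearMap.id) ?_
      apply BarTerm.hom_ext
      intro e b m
      simp only [LinearMap.add_apply, LinearMap.comp_apply, LinearMap.restrictScalars_apply,
        barContraction_tmul_tprod, barD_zero_tmul_tprod, barAug_tmul_tprod, barSection_apply,
        Fin.cons_zero, one_mul, sub_add_cancel, LinearMap.id_apply]
      rw [Subsingleton.elim m Fin.elim0]

/-! ## The relative `Tor` as Hochschild homology -/

variable (X : Type u) [AddCommGroup X] [Module k X] [Module (TriAlg A B M) X]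
  [Module (TriAlg A B M)ᵐᵒᵖ X] [SMulCommClass (TriAlg A B M) (TriAlg A B M)ᵐᵒᵖ X]
  [IsScalarTower k (TriAlg A B M) X] [IsScalarTower k (TriAlg A B M)ᵐᵒᵖ X]

/-- The map `r ↦ x r` from `E ⊗ B` to `1_B X`, as a function of `x`. -/
def BarCoeff.toBX : BX k A B M X →ₗ[k] BarCoeff k A B M →ₗ[k] BX k A B M X :=
  ((Algebra.lsmul k k (BX k A B M X) :
      (TriAlg A B M ⊗[k] Bᵐᵒᵖ)ᵐᵒᵖ →ₐ[k] Module.End k (BX k A B M X)).toLinearMap.comp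
    ((opLinearEquiv k : (TriAlg A B M ⊗[k] Bᵐᵒᵖ) ≃ₗ[k] _).toLinearMap.comp
      ((BarCoeff.of k A B M).symm.toLinearMap.restrictScalars k))).flip

theorem BarCoeff.toBX_of (x : BX k A B M X) (r : TriAlg A B M ⊗[k] Bᵐᵒᵖ) :
    BarCoeff.toBX k A B M X x (BarCoeff.of k A B M r) = op r • x := rfl

/-- The map `r ↦ x r` from `E ⊗ B` to `1_B X`, as a morphism of pairs over `E`. -/
def BarCoeff.toBXPair (x : BX k A B M X) :
    Hochschild.PairHom k (TriAlg A B M) (BarCoeff k A B M) (TriAlg A B M) (BX k A B M X) :=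
  .ofBimoduleMap (BarCoeff.toBX k A B M X x)
    (fun e r => by
      obtain ⟨r, rfl⟩ := (BarCoeff.of k A B M).surjective r
      rw [BarCoeff.lsmul_of, BarCoeff.toBX_of, BarCoeff.toBX_of, op_mul, mul_smul,
        BX.op_tmul_smul, op_one, one_smul, BX.tri_smul])
    (fun e r => by
      obtain ⟨r, rfl⟩ := (BarCoeff.of k A B M).surjective r
      rw [BarCoeff.rsmul_of, BarCoeff.toBX_of, BarCoeff.toBX_of, op_mul, mul_smul,
        ← op_one, BX.op_tmul_smul, one_smul])

/-- The map `1_B X ⊗_{E ⊗ B^op} ((E ⊗ B) ⊗ E^{⊗ n}) → 1_B X ⊗ E^{⊗ n}`,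
`x ⊗ (r ⊗ t) ↦ x r ⊗ t`. -/
def barTensorToChain (n : ℕ) :
    BalancedTensor k (TriAlg A B M ⊗[k] Bᵐᵒᵖ) (BX k A B M X) (BarTerm k A B M n)
      →ₗ[k] Hochschild.Chain k (TriAlg A B M) (BX k A B M X) n :=
  (balancedRel k (TriAlg A B M ⊗[k] Bᵐᵒᵖ) (BX k A B M X) (BarTerm k A B M n)).liftQ
    (TensorProduct.lift ((LinearMap.rTensorHom (⨂[k]^n (TriAlg A B M))).comp
      (BarCoeff.toBX k A B M X))) (by
    rw [balancedRel, Submodule.span_le]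
    rintro _ ⟨x, r, p, rfl⟩
    rw [SetLike.mem_coe, LinearMap.mem_ker, map_sub, sub_eq_zero, TensorProduct.lift.tmul,
      TensorProduct.lift.tmul]
    -- Balancedness is the associativity (x r) s = x (r s) of the right action.
    induction p using TensorProduct.induction_on with
    | zero => simp only [smul_zero, map_zero]
    | add p q hp hq => simp only [smul_add, map_add, hp, hq]
    | tmul s t =>
      obtain ⟨s, rfl⟩ := (BarCoeff.of k A B M).surjective s
      rw [TensorProduct.smul_tmul']
      simp only [LinearMap.comp_apply, LinearMap.coe_rTensorHom, LinearMap.rTensor_tmul,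
        BarCoeff.smul_of, BarCoeff.toBX_of, op_mul, mul_smul])

/-- For fixed x the comparison is induced by the bimodule map r ↦ x r, so its compatibility with the
differentials is an instance of naturality. -/
theorem barTensorToChain_mk_tmul (n : ℕ) (x : BX k A B M X) (p : BarTerm k A B M n) :
    barTensorToChain k A B M X n (Submodule.Quotient.mk (x ⊗ₜ p))
      = (BarCoeff.toBXPair k A B M X x).chainMap n p := by
  rw [BarCoeff.toBXPair, Hochschild.PairHom.ofBimoduleMap_chainMap]
  rfl

theorem barTensorToChain_mk_tmul_tmul (n : ℕ) (x : BX k A B M X) (r : TriAlg A B M ⊗[k] Bᵐᵒᵖ)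
    (t : ⨂[k]^n (TriAlg A B M)) :
    barTensorToChain k A B M X n (Submodule.Quotient.mk (x ⊗ₜ (BarCoeff.of k A B M r ⊗ₜ t)))
      = (op r • x) ⊗ₜ t := rfl

/-- The map `x ⊗ t ↦ x ⊗ (1 ⊗ t)`. -/
def chainToBarTensor (n : ℕ) :
    Hochschild.Chain k (TriAlg A B M) (BX k A B M X) n →ₗ[k]
      BalancedTensor k (TriAlg A B M ⊗[k] Bᵐᵒᵖ) (BX k A B M X) (BarTerm k A B M n) :=
  (Submodule.mkQ _).comp (LinearMap.lTensor _
    (TensorProduct.mk k (BarCoeff k A B M) (⨂[k]^n (TriAlg A B M)) (BarCoeff.of k A B M 1)))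

theorem chainToBarTensor_tmul (n : ℕ) (x : BX k A B M X) (t : ⨂[k]^n (TriAlg A B M)) :
    chainToBarTensor k A B M X n (x ⊗ₜ t)
      = Submodule.Quotient.mk (x ⊗ₜ (BarCoeff.of k A B M 1 ⊗ₜ t)) := rfl

/-- `1_B X ⊗_{E ⊗ B^op} ((E ⊗ B) ⊗ E^{⊗ n}) ≅ 1_B X ⊗ E^{⊗ n}`. -/
def barTensorEquiv (n : ℕ) :
    BalancedTensor k (TriAlg A B M ⊗[k] Bᵐᵒᵖ) (BX k A B M X) (BarTerm k A B M n)
      ≃ₗ[k] Hochschild.Chain k (TriAlg A B M) (BX k A B M X) n :=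
  LinearEquiv.ofLinearMap (barTensorToChain k A B M X n) (chainToBarTensor k A B M X n)
    (TensorProduct.ext' fun x t => by
      rw [LinearMap.comp_apply, chainToBarTensor_tmul, barTensorToChain_mk_tmul_tmul, op_one,
        one_smul, LinearMap.id_apply])
    (BalancedTensor.hom_ext _ fun x p => by
      induction p using TensorProduct.induction_on with
      | zero => simp only [TensorProduct.tmul_zero, Submodule.Quotient.mk_zero, map_zero]
      | add p q hp hq =>
        simp only [TensorProduct.tmul_add, Submodule.Quotient.mk_add, map_add, hp, hq]
      | tmul r t =>
        obtain ⟨r, rfl⟩ := (BarCoeff.of k A B M).surjective r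
        rw [LinearMap.comp_apply, barTensorToChain_mk_tmul_tmul, chainToBarTensor_tmul,
          LinearMap.id_apply, Submodule.Quotient.eq]
        -- The defining relation moves r across: x r ⊗ (1 ⊗ t) = x ⊗ (r ⊗ t).
        refine Submodule.subset_span ⟨x, r, BarCoeff.of k A B M 1 ⊗ₜ t, ?_⟩
        rw [TensorProduct.smul_tmul', BarCoeff.smul_of, mul_one])

/-- The complex `1_B X ⊗_{E ⊗ B^op} P_*` of the bar resolution is the Hochschild complex of `E` with
coefficients in `1_B X`. -/
def barTorComplexIso :
    (barResolution k A B M).torComplex (BX k A B M X)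
      ≅ Hochschild.complex k (TriAlg A B M) (BX k A B M X) :=
  HomologicalComplex.Hom.isoOfComponents
    (fun n => (barTensorEquiv k A B M X n).toModuleIso) (by
      rintro i n rfl
      rw [Hochschild.complex_d, RelProjResolution.torComplex_d]
      refine congrArg ModuleCat.ofHom (?_ :
        (Hochschild.boundary k _ _ n).comp (barTensorToChain k A B M X (n + 1))
          = (barTensorToChain k A B M X n).comp (BalancedTensor.map k _ _ (barD k A B M n)))
      refine BalancedTensor.hom_ext _ fun x p => ?_
      rw [LinearMap.comp_apply, LinearMap.comp_apply, BalancedTensor.map_mk_tmul,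
        barTensorToChain_mk_tmul, barTensorToChain_mk_tmul]
      exact LinearMap.congr_fun ((BarCoeff.toBXPair k A B M X x).boundary_chainMap n) p)

/-- `H_n(E, 1_B X) ≅ Tor_n^{E ⊗ B^op, k}(B_E, 1_B X)`. -/
def homologyIsoTor (P : RelProjResolution k (TriAlg A B M ⊗[k] Bᵐᵒᵖ) (BE A B M)) (n : ℕ) :
    Hochschild.homology k (TriAlg A B M) (BX k A B M X) n ≅ P.tor (BX k A B M X) n :=
  ((HomologicalComplex.homologyFunctor _ _ n).mapIso (barTorComplexIso k A B M X)).symm ≪≫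
    (barResolution k A B M).torIso (BX k A B M X) P n

end bar

/-! ### The long exact sequence -/

theorem theorem2 (k : Type u) [CommRing k] (A B M : Type u) [Ring A] [Ring B]
    [Algebra k A] [Algebra k B]
    [AddCommGroup M] [Module k M] [Module A M] [Module Bᵐᵒᵖ M] [SMulCommClass A Bᵐᵒᵖ M]
    [IsScalarTower k A M] [IsScalarTower k Bᵐᵒᵖ M]
    (X : Type u) [AddCommGroup X] [Module k X]
    [Module (TriAlg A B M) X] [Module (TriAlg A B M)ᵐᵒᵖ X]
    [SMulCommClass (TriAlg A B M) (TriAlg A B M)ᵐᵒᵖ X]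
    [IsScalarTower k (TriAlg A B M) X] [IsScalarTower k (TriAlg A B M)ᵐᵒᵖ X]
    (P : RelProjResolution k (TriAlg A B M ⊗[k] Bᵐᵒᵖ) (BE A B M)) :
    ∃ (f : ∀ n, Hochschild.homology k A (XAA k A B M X) n →ₗ[k]
          Hochschild.homology k (TriAlg A B M) X n)
      (g : ∀ n, Hochschild.homology k (TriAlg A B M) X n →ₗ[k] P.tor (BX k A B M X) n)
      (δ : ∀ n, P.tor (BX k A B M X) (n + 1) →ₗ[k]
          Hochschild.homology k A (XAA k A B M X) n),
      (∀ n, Function.Exact (f n) (g n)) ∧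
      (∀ n, Function.Exact (g (n + 1)) (δ n)) ∧
      (∀ n, Function.Exact (δ n) (f n)) ∧
      Function.Surjective (g 0) := by
  have hS := cornerShortComplex_shortExact k A B M X
  let iA := fun n => (cornerHomologyIso k A B M X n).toLinearEquiv
  let iT := fun n => (homologyIsoTor k A B M X P n).toLinearEquiv
  let f : ∀ n, Hochschild.homology k (TriAlg A B M) (AX k A B M X) n →ₗ[k]
      Hochschild.homology k (TriAlg A B M) X n := fun n =>
    (HomologicalComplex.homologyMap (cornerShortComplex k A B M X).f n).hom
  let g : ∀ n, Hochschild.homology k (TriAlg A B M) X n →ₗ[k]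
      Hochschild.homology k (TriAlg A B M) (BX k A B M X) n := fun n =>
    (HomologicalComplex.homologyMap (cornerShortComplex k A B M X).g n).hom
  let δ : ∀ n, Hochschild.homology k (TriAlg A B M) (BX k A B M X) (n + 1) →ₗ[k]
      Hochschild.homology k (TriAlg A B M) (AX k A B M X) n := fun n =>
    (hS.δ (n + 1) n rfl).hom
  have h₁ : ∀ n, Function.Exact (δ n) (f n) := fun n =>
    (ShortComplex.ShortExact.moduleCat_exact_iff_function_exact _).1 (hS.homology_exact₁ _ _ rfl)
  have h₂ : ∀ n, Function.Exact (f n) (g n) := fun n =>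
    (ShortComplex.ShortExact.moduleCat_exact_iff_function_exact _).1 (hS.homology_exact₂ n)
  have h₃ : ∀ n, Function.Exact (g (n + 1)) (δ n) := fun n =>
    (ShortComplex.ShortExact.moduleCat_exact_iff_function_exact _).1
      (hS.homology_exact₃ (n + 1) n rfl)
  have h₄ : Function.Surjective (g 0) := by
    -- No differential leaves degree zero, so an epimorphism of complexes stays epimorphic on H_0.
    have := hS.epi_g
    have := HomologicalComplex.epi_homologyMap_of_epi_of_not_rel (cornerShortComplex k A B M X).g 0
      (by simp)
    exact (ModuleCat.epi_iff_surjective _).1 this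
  -- The sequence is transported along `iA` and `iT`, and exactness is unaffected by replacing terms
  -- with isomorphic ones.
  refine ⟨fun n => (f n).comp (iA n).toLinearMap, fun n => (iT n).toLinearMap.comp (g n),
    fun n => (iA n).symm.toLinearMap.comp ((δ n).comp (iT (n + 1)).symm.toLinearMap),
    fun n => ?_, fun n => ?_, fun n => ?_, (iT 0).surjective.comp h₄⟩
  · exact (iT n).postcomp_exact_iff_exact.2 ((iA n).precomp_exact_iff_exact.2 (h₂ n))
  · exact (iA n).symm.postcomp_exact_iff_exact.2
      ((LinearEquiv.conj_exact_iff_exact _ _ (iT (n + 1))).2 (h₃ n))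
  · exact (LinearEquiv.conj_symm_exact_iff_exact _ _ (iA n)).2
      ((iT (n + 1)).symm.precomp_exact_iff_exact.2 (h₁ n))

end
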